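/- Let $S^2\subset\mathbb{R}^3$ be the unit sphere with the topological quandle structure $a\star b=i_b(a)$, where $i_b(a)=2\langle a,b\rangle b-a$ is the geodesic symmetry of $S^2$ at $b$. The braid group $B_n$ acts from the right on $(S^2)^n$ by letting $\sigma_i$ send $(\dots,x_i,x_{i+1},\dots)$ to $(\dots,x_{i+1},x_i\star x_{i+1},\dots)$. If a link $L$ is the closure of $\beta\in B_n$, then its invariant space $J_{S^2}(L)\subset (S^2)^n$ is the fixed point set of $\beta$. Let $K$ be the figure-eight knot, the closure of $(\sigma_1\sigma_2^{-1})^2\in B_3$. (1) For every $n\ge 1$ and every braid $\beta\in B_n$ that is Markov equivalent to $(\sigma_1\sigma_2^{-1})^2$ (that is, whose closure is $K$), the space $J_{S^2}(K)\subset(S^2)^n\subset(\mathbb{R}^3)^n$ computed from $\beta$ has exactly three connected components. They are smooth submanifolds, one of them diffeomorphic to $S^2$ and each of the other two diffeomorphic to $\mathbb{R}P^3$. (2) The standard four-crossing diagram of $K$ has arcs $1,2,3,4$, and its crossings are (over; left, right) $=(1;2,3),(3;4,1),(2;4,3),(4;2,1)$. A colouring is an assignment of points $x_1,\dots,x_4\in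 S^2$ to the arcs such that $x_{\mathrm{right}}=x_{\mathrm{left}}\star x_{\mathrm{over}}$ at every crossing. The map sending a colouring to $(a,b)=(x_1,x_2)$ is a homeomorphism from the space of all colourings (a subspace of $(S^2)^4$) onto the subspace $$J=\{(a,b)\in S^2\times S^2:\ \angle(a,b)\in\{0,\,2\pi/5,\,4\pi/5\}\}.$$ The space $J$ has exactly three connected components: the diagonal $\{(a,a)\}$, the set $\{\angle(a,b)=2\pi/5\}$ and the set $\{\angle(a,b)=4\pi/5\}$. The first is diffeomorphic to $S^2$, and each of the other two is diffeomorphic to $\mathbb{R}P^3$. -/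

import Mathlib

open Set Topology Quandles
open scoped Manifold ContDiff

/-! ### Topological quandles -/

/-- A topological quandle.  Mathlib writes the quandle operation as a left action: the element
`a ⋆ b` (the right translation by `b` applied to `a`) is `b ◃ a`.  Continuity of `(b, a) ↦ b ◃ a`
together with continuity of each inverse translation says that the operation is continuous and
that every translation `a ↦ a ⋆ b` is a homeomorphism. -/
class TopologicalQuandle (Q : Type*) [TopologicalSpace Q] extends Quandle Q where
  continuous_act : Continuous fun p : Q × Q => p.1 ◃ p.2
  continuous_invAct : ∀ b : Q, Continuous fun a : Q => b ◃⁻¹ a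

/-! ### The two-sphere as a topological quandle -/

/-- Euclidean three-space. -/
abbrev E3 : Type := EuclideanSpace ℝ (Fin 3)

/-- The unit two-sphere in Euclidean three-space, with Mathlib's topology and smooth structure. -/
abbrev S2 : Type := Metric.sphere (0 : E3) 1

theorem S2.inner_self (a : S2) : inner ℝ (a : E3) (a : E3) = 1 := by
  have h : ‖(a : E3)‖ = 1 := by simp
  rw [real_inner_self_eq_norm_sq, h]; norm_num

/-- The geodesic symmetry of the two-sphere at the point `b`, applied to `a`:
it is the half-turn about the axis through `b`, that is `a ↦ 2 ⟨a, b⟩ b - a`. -/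
noncomputable def S2.sym (b a : S2) : S2 :=
  ⟨(2 * inner ℝ (a : E3) (b : E3)) • (b : E3) - (a : E3), by
    have ha := S2.inner_self a
    have hb := S2.inner_self b
    rw [mem_sphere_zero_iff_norm, ← sq_eq_sq₀ (norm_nonneg _) zero_le_one,
      ← real_inner_self_eq_norm_sq]
    simp only [inner_sub_left, inner_sub_right, real_inner_smul_left, real_inner_smul_right,
      ha, hb, real_inner_comm (a : E3) (b : E3)]
    ring⟩

theorem S2.coe_sym (b a : S2) :
    (S2.sym b a : E3) = (2 * inner ℝ (a : E3) (b : E3)) • (b : E3) - (a : E3) := rfl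

theorem S2.sym_sym (b a : S2) : S2.sym b (S2.sym b a) = a := by
  have hb := S2.inner_self b
  ext1
  simp only [S2.coe_sym, inner_sub_left, real_inner_smul_left, hb]
  module

/-- The geodesic symmetry at `b` is an isometry. -/
theorem S2.inner_sym_sym (b a c : S2) :
    inner ℝ (S2.sym b a : E3) (S2.sym b c : E3) = inner ℝ (a : E3) (c : E3) := by
  have hb := S2.inner_self b
  simp only [S2.coe_sym, inner_sub_left, inner_sub_right, real_inner_smul_left,
    real_inner_smul_right, hb, real_inner_comm (c : E3) (b : E3)]
  ring

theorem S2.sym_distrib (x y z : S2) :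
    S2.sym x (S2.sym y z) = S2.sym (S2.sym x y) (S2.sym x z) := by
  ext1
  rw [S2.coe_sym (S2.sym x y), S2.inner_sym_sym]
  simp only [S2.coe_sym, inner_sub_left, real_inner_smul_left]
  module

theorem S2.sym_self (b : S2) : S2.sym b b = b := by
  have hb := S2.inner_self b
  ext1
  simp only [S2.coe_sym, hb]
  module

/-- The fixed points of the geodesic symmetry at `b` are `b` and `-b`; in particular `b` is an
isolated fixed point. -/
theorem S2.sym_eq_iff (b a : S2) : S2.sym b a = a ↔ a = b ∨ a = -b := by
  have ha := S2.inner_self a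
  have hb := S2.inner_self b
  constructor
  · intro h
    have h1 : (2 * inner ℝ (a : E3) (b : E3)) • (b : E3) - (a : E3) = a := congrArg Subtype.val h
    have h2 : (a : E3) = (inner ℝ (a : E3) (b : E3)) • (b : E3) := by
      have h3 : (2 : ℝ) • (a : E3) = (2 : ℝ) • ((inner ℝ (a : E3) (b : E3)) • (b : E3)) := by
        rw [two_smul, smul_smul]
        exact (sub_eq_iff_eq_add.mp h1).symm
      exact smul_right_injective _ (two_ne_zero (α := ℝ)) h3
    have h4 : inner ℝ (a : E3) (b : E3) * inner ℝ (a : E3) (b : E3) = 1 := by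
      have h5 : inner ℝ (a : E3) (a : E3) = inner ℝ (a : E3) (b : E3) * inner ℝ (a : E3) (b : E3) := by
        calc inner ℝ (a : E3) (a : E3)
            = inner ℝ (a : E3) ((inner ℝ (a : E3) (b : E3)) • (b : E3)) := congrArg _ h2
          _ = _ := real_inner_smul_right _ _ _
      rw [← h5, ha]
    rcases mul_self_eq_one_iff.mp h4 with h5 | h5
    · left; ext1; rw [h2, h5, one_smul]
    · right; ext1; rw [h2, h5]; simp
  · rintro (rfl | rfl)
    · exact S2.sym_self _
    · ext1
      simp only [S2.coe_sym, coe_neg_sphere, inner_neg_left, hb]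
      module

/-- The two-sphere with the quandle operation `a ⋆ b = i_b a`, where `i_b` is the geodesic
symmetry at `b`. -/
noncomputable instance S2.instTopologicalQuandle : TopologicalQuandle S2 where
  act := S2.sym
  self_distrib := S2.sym_distrib _ _ _
  invAct := S2.sym
  left_inv := S2.sym_sym
  right_inv := S2.sym_sym
  fix := S2.sym_self _
  continuous_act := by
    refine Continuous.subtype_mk ?_ _
    fun_prop
  continuous_invAct b := by
    refine Continuous.subtype_mk ?_ _
    fun_prop

/-! ### Braids, their action on powers of a quandle, and the invariant space -/

/-- The defining relations of the braid group on `m + 1` strands, in the free group on the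
elementary braids `σ_i`, `i : Fin m`. -/
def braidRelations (m : ℕ) : Set (FreeGroup (Fin m)) :=
  {r | ∃ i j : Fin m, i.val + 1 < j.val ∧
      r = FreeGroup.of i * FreeGroup.of j * (FreeGroup.of j * FreeGroup.of i)⁻¹} ∪
  {r | ∃ i j : Fin m, i.val + 1 = j.val ∧
      r = FreeGroup.of i * FreeGroup.of j * FreeGroup.of i *
        (FreeGroup.of j * FreeGroup.of i * FreeGroup.of j)⁻¹}

/-- The braid group on `m + 1` strands. -/
abbrev BraidGroup (m : ℕ) : Type := PresentedGroup (braidRelations m)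

/-- The elementary braid exchanging the strands `i` and `i + 1`. -/
def BraidGroup.σ {m : ℕ} (i : Fin m) : BraidGroup m := PresentedGroup.of i

theorem BraidGroup.σ_comm {m : ℕ} {i j : Fin m} (h : i.val + 1 < j.val) :
    BraidGroup.σ i * BraidGroup.σ j = BraidGroup.σ j * BraidGroup.σ i := by
  have h1 : PresentedGroup.mk (braidRelations m)
      (FreeGroup.of i * FreeGroup.of j * (FreeGroup.of j * FreeGroup.of i)⁻¹) = 1 :=
    PresentedGroup.one_of_mem (Or.inl ⟨i, j, h, rfl⟩)
  rw [map_mul, map_inv, mul_inv_eq_one, map_mul, map_mul] at h1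
  exact h1

theorem BraidGroup.σ_braid {m : ℕ} {i j : Fin m} (h : i.val + 1 = j.val) :
    BraidGroup.σ i * BraidGroup.σ j * BraidGroup.σ i =
      BraidGroup.σ j * BraidGroup.σ i * BraidGroup.σ j := by
  have h1 : PresentedGroup.mk (braidRelations m)
      (FreeGroup.of i * FreeGroup.of j * FreeGroup.of i *
        (FreeGroup.of j * FreeGroup.of i * FreeGroup.of j)⁻¹) = 1 :=
    PresentedGroup.one_of_mem (Or.inr ⟨i, j, h, rfl⟩)
  rw [map_mul, map_inv, mul_inv_eq_one, map_mul, map_mul, map_mul, map_mul] at h1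
  exact h1

/-- The standard inclusion of the braid group on `m + 1` strands into the one on `m + 2` strands. -/
def BraidGroup.incl (m : ℕ) : BraidGroup m →* BraidGroup (m + 1) :=
  PresentedGroup.toGroup (f := fun i : Fin m => BraidGroup.σ i.castSucc) (by
    rintro r (⟨i, j, h, rfl⟩ | ⟨i, j, h, rfl⟩)
    · simp only [map_mul, map_inv, FreeGroup.lift_apply_of, mul_inv_eq_one]
      exact BraidGroup.σ_comm (by simpa using h)
    · simp only [map_mul, map_inv, FreeGroup.lift_apply_of, mul_inv_eq_one]
      exact BraidGroup.σ_braid (by simpa using h))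

/-- One step of Markov's theorem: conjugation of a braid, or its (positive or negative)
stabilization. -/
inductive MarkovStep : (Σ m : ℕ, BraidGroup m) → (Σ m : ℕ, BraidGroup m) → Prop
  | conj (m : ℕ) (β γ : BraidGroup m) : MarkovStep ⟨m, β⟩ ⟨m, γ * β * γ⁻¹⟩
  | stab (m : ℕ) (β : BraidGroup m) :
      MarkovStep ⟨m, β⟩ ⟨m + 1, BraidGroup.incl m β * BraidGroup.σ (Fin.last m)⟩
  | stabInv (m : ℕ) (β : BraidGroup m) :
      MarkovStep ⟨m, β⟩ ⟨m + 1, BraidGroup.incl m β * (BraidGroup.σ (Fin.last m))⁻¹⟩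

/-- Markov equivalence of braids.  By the theorems of Alexander and Markov, closing braids
identifies its classes with the isotopy classes of oriented (non-empty) links in `ℝ³`. -/
def MarkovEquivalent : (Σ m : ℕ, BraidGroup m) → (Σ m : ℕ, BraidGroup m) → Prop :=
  Relation.EqvGen MarkovStep

/-- The action of the elementary braid `σ_i` on a power of a quandle:
`(…, x_i, x_{i+1}, …) ↦ (…, x_{i+1}, x_i ⋆ x_{i+1}, …)`. -/
def elementaryAct (Q : Type*) [Quandle Q] {m : ℕ} (i : Fin m) : Equiv.Perm (Fin (m + 1) → Q) where
  toFun x := fun j =>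
    if j = i.castSucc then x i.succ
    else if j = i.succ then x i.succ ◃ x i.castSucc
    else x j
  invFun y := fun j =>
    if j = i.castSucc then y i.castSucc ◃⁻¹ y i.succ
    else if j = i.succ then y i.castSucc
    else y j
  left_inv x := by
    have hne : i.succ ≠ i.castSucc := (Fin.castSucc_lt_succ (i := i)).ne'
    funext j
    by_cases h1 : j = i.castSucc
    · subst h1; simp [hne]
    · by_cases h2 : j = i.succ
      · subst h2; simp [hne]
      · simp [h1, h2]
  right_inv y := by
    have hne : i.succ ≠ i.castSucc := (Fin.castSucc_lt_succ (i := i)).ne'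
    funext j
    by_cases h1 : j = i.castSucc
    · subst h1; simp [hne]
    · by_cases h2 : j = i.succ
      · subst h2; simp [hne]
      · simp [h1, h2]

theorem elementaryAct_apply (Q : Type*) [Quandle Q] {m : ℕ} (i : Fin m) (x : Fin (m + 1) → Q)
    (j : Fin (m + 1)) :
    elementaryAct Q i x j = if j = i.castSucc then x i.succ
      else if j = i.succ then x i.succ ◃ x i.castSucc else x j := rfl

/-- The right action of the braid group on a power of a quandle: in a product `β * γ` the braid
`β` acts first. -/
def braidAct (Q : Type*) [Quandle Q] (m : ℕ) : BraidGroup m →* (Equiv.Perm (Fin (m + 1) → Q))ᵐᵒᵖ :=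
  PresentedGroup.toGroup (f := fun i : Fin m => MulOpposite.op (elementaryAct Q i)) (by
    rintro r (⟨i, j, h, rfl⟩ | ⟨i, j, h, rfl⟩)
    · simp only [map_mul, map_inv, FreeGroup.lift_apply_of, mul_inv_eq_one]
      rw [← MulOpposite.op_mul, ← MulOpposite.op_mul]
      congr 1
      ext x k
      simp only [Equiv.Perm.mul_apply, elementaryAct_apply, Fin.ext_iff, Fin.val_succ,
        Fin.val_castSucc]
      have e1 : ¬ (j.val + 1 = i.val) := by omega
      have e2 : ¬ (j.val + 1 = i.val + 1) := by omega
      have e3 : ¬ (j.val = i.val) := by omega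
      have e4 : ¬ (j.val = i.val + 1) := by omega
      have e5 : ¬ (i.val + 1 = j.val) := by omega
      have e6 : ¬ (i.val + 1 = j.val + 1) := by omega
      have e7 : ¬ (i.val = j.val) := by omega
      have e8 : ¬ (i.val = j.val + 1) := by omega
      simp only [e1, e2, e3, e4, e5, e6, e7, e8, if_false]
      split_ifs <;> first | rfl | omega
    · simp only [map_mul, map_inv, FreeGroup.lift_apply_of, mul_inv_eq_one]
      simp only [← MulOpposite.op_mul]
      congr 1
      ext x k
      have hj : j.castSucc = i.succ := by
        apply Fin.ext; simp only [Fin.val_castSucc, Fin.val_succ]; omega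
      have f1 : i.succ ≠ i.castSucc := (Fin.castSucc_lt_succ (i := i)).ne'
      have f2 : j.succ ≠ i.succ := by
        intro hh; have := congrArg Fin.val hh; simp only [Fin.val_succ] at this; omega
      have f3 : j.succ ≠ i.castSucc := by
        intro hh; have := congrArg Fin.val hh
        simp only [Fin.val_succ, Fin.val_castSucc] at this; omega
      simp only [Equiv.Perm.mul_apply, elementaryAct_apply, hj]
      by_cases h1 : k = i.castSucc
      · subst h1; simp [f1, f1.symm, f2, f3, f3.symm]
      · by_cases h2 : k = i.succ
        · subst h2; simp [f1, f1.symm, f2, f3, f3.symm]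
        · by_cases h3 : k = j.succ
          · subst h3
            simp [f1, f1.symm, f2, f3, f3.symm]
            exact Shelf.self_distrib
          · simp [h1, h2, h3])

/-- The invariant space `J_Q` of the closure of the braid `β`: the fixed points of `β` acting on
the power of `Q` indexed by the strands. -/
def invariantSpace (Q : Type*) [TopologicalSpace Q] [TopologicalQuandle Q] {m : ℕ}
    (β : BraidGroup m) : Set (Fin (m + 1) → Q) :=
  {x | (braidAct Q m β).unop x = x}

/-- The three-strand braid `(σ₁ σ₂⁻¹)²`, whose closure is the figure-eight knot. -/
def figureEightBraid : BraidGroup 2 :=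
  (BraidGroup.σ 0 * (BraidGroup.σ 1)⁻¹) ^ 2

/-! ### Colourings of link diagrams -/

/-- A crossing of an oriented link diagram with set of arcs `A`: the overcrossing arc, and the
arcs lying to the left and to the right of the (directed) overcrossing arc. -/
structure DiagramCrossing (A : Type*) where
  overArc : A
  leftArc : A
  rightArc : A

/-- The space of colourings, by a topological quandle `Q`, of an oriented diagram with set of arcs
`A` and the given crossings: at each crossing, `right = left ⋆ over` for the colours of the three arcs. -/
def colouringSpace (Q : Type*) [TopologicalSpace Q] [TopologicalQuandle Q] {A : Type*}
    (D : List (DiagramCrossing A)) : Set (A → Q) :=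
  {x | ∀ c ∈ D, x c.rightArc = x c.overArc ◃ x c.leftArc}

/-- The standard alternating diagram of the figure-eight knot with four arcs and four crossings.
The arcs `1, 2, 3, 4` of the usual picture are `0, 1, 2, 3` here. -/
def figureEightDiagram : List (DiagramCrossing (Fin 4)) :=
  [⟨0, 1, 2⟩, ⟨2, 3, 0⟩, ⟨1, 3, 2⟩, ⟨3, 1, 0⟩]

/-! ### Real projective space as a smooth manifold -/

/-- Real projective `n`-space: the lines through the origin of `ℝⁿ⁺¹`. -/
def RealProjectiveSpace (n : ℕ) : Type := Projectivization ℝ (Fin (n + 1) → ℝ)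

namespace RealProjectiveSpace

variable {n : ℕ}

/-- The point of projective space with homogeneous coordinates `v`. -/
noncomputable def mk (v : {v : Fin (n + 1) → ℝ // v ≠ 0}) : RealProjectiveSpace n :=
  Projectivization.mk' ℝ v

theorem mk_surjective : Function.Surjective (mk (n := n)) := by
  intro p
  exact ⟨⟨Projectivization.rep p, Projectivization.rep_nonzero p⟩, Projectivization.mk_rep p⟩

theorem mk_eq_mk_iff (v w : {v : Fin (n + 1) → ℝ // v ≠ 0}) :
    mk v = mk w ↔ ∃ t : ℝ, t • (w : Fin (n + 1) → ℝ) = v :=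
  Projectivization.mk_eq_mk_iff' ℝ v.1 w.1 v.2 w.2

/-- The quotient topology. -/
noncomputable instance : TopologicalSpace (RealProjectiveSpace n) := TopologicalSpace.coinduced mk inferInstance

theorem isQuotientMap_mk : IsQuotientMap (mk (n := n)) := ⟨⟨rfl⟩, mk_surjective⟩

/-- The ratio `x_j / x_i` of two homogeneous coordinates. -/
noncomputable def ratio (j i : Fin (n + 1)) (p : RealProjectiveSpace n) : ℝ :=
  Projectivization.lift (K := ℝ) (V := Fin (n + 1) → ℝ) (fun v => v.1 j / v.1 i) (by
    rintro ⟨a, ha⟩ ⟨b, hb⟩ t h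
    have h' : a = t • b := h
    have ht : t ≠ 0 := by rintro rfl; exact ha (by simpa using h')
    subst h'
    simp only [Pi.smul_apply, smul_eq_mul]
    exact mul_div_mul_left _ _ ht) p

@[simp] theorem ratio_mk (j i : Fin (n + 1)) (v : {v : Fin (n + 1) → ℝ // v ≠ 0}) :
    ratio j i (mk v) = v.1 j / v.1 i := rfl

/-- The set of points with non-zero `i`-th homogeneous coordinate. -/
def affineOpen (i : Fin (n + 1)) : Set (RealProjectiveSpace n) := {p | ratio i i p ≠ 0}

@[simp] theorem mk_mem_affineOpen (i : Fin (n + 1)) (v : {v : Fin (n + 1) → ℝ // v ≠ 0}) :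
    mk v ∈ affineOpen i ↔ v.1 i ≠ 0 := by
  simp [affineOpen]

theorem isOpen_affineOpen (i : Fin (n + 1)) : IsOpen (affineOpen (n := n) i) := by
  rw [← isQuotientMap_mk.isOpen_preimage]
  have : mk ⁻¹' affineOpen i = {v : {v : Fin (n + 1) → ℝ // v ≠ 0} | v.1 i ≠ 0} := by
    ext v; simp
  rw [this]
  exact isOpen_ne_fun ((continuous_apply i).comp continuous_subtype_val) continuous_const

/-- The vector with `i`-th coordinate `1` and the remaining coordinates given by `y`. -/
noncomputable def affineLift (i : Fin (n + 1)) (y : Fin n → ℝ) : {v : Fin (n + 1) → ℝ // v ≠ 0} :=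
  ⟨i.insertNth (α := fun _ => ℝ) 1 y, fun h => one_ne_zero (α := ℝ) (by
    simpa using congrFun h i)⟩

/-- The `i`-th standard affine chart `[x] ↦ (x_j / x_i)_{j ≠ i}` of projective space. -/
noncomputable def affineChart (i : Fin (n + 1)) :
    OpenPartialHomeomorph (RealProjectiveSpace n) (Fin n → ℝ) where
  toFun p := fun k => ratio (i.succAbove k) i p
  invFun y := mk (affineLift i y)
  source := affineOpen i
  target := univ
  map_source' _ _ := mem_univ _
  map_target' y _ := by simp [affineLift]
  left_inv' p hp := by
    obtain ⟨v, rfl⟩ := mk_surjective p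
    rw [mk_mem_affineOpen] at hp
    rw [mk_eq_mk_iff]
    refine ⟨(v.1 i)⁻¹, ?_⟩
    funext j
    rcases Fin.eq_self_or_eq_succAbove i j with rfl | ⟨k, rfl⟩
    · simp [affineLift, hp]
    · simp [affineLift, div_eq_inv_mul]
  right_inv' y _ := by
    funext k
    simp [affineLift]
  open_source := isOpen_affineOpen i
  open_target := isOpen_univ
  continuousOn_toFun := by
    rw [isQuotientMap_mk.continuousOn_isOpen_iff (isOpen_affineOpen i)]
    refine continuousOn_pi.mpr fun k => ?_
    refine ContinuousOn.div ((continuous_apply _).comp continuous_subtype_val).continuousOn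
      ((continuous_apply _).comp continuous_subtype_val).continuousOn ?_
    intro v hv
    simpa using hv
  continuousOn_invFun := by
    refine (isQuotientMap_mk.continuous.comp ?_).continuousOn
    refine Continuous.subtype_mk ?_ _
    exact continuous_const.finInsertNth i continuous_id

theorem exists_mem_affineOpen (p : RealProjectiveSpace n) : ∃ i, p ∈ affineOpen i := by
  obtain ⟨v, rfl⟩ := mk_surjective p
  obtain ⟨i, hi⟩ := Function.ne_iff.mp v.2
  exact ⟨i, by simpa using hi⟩

/-- The manifold structure given by the standard affine charts. -/
noncomputable instance : ChartedSpace (Fin n → ℝ) (RealProjectiveSpace n) where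
  atlas := range affineChart
  chartAt p := affineChart (exists_mem_affineOpen p).choose
  mem_chart_source p := (exists_mem_affineOpen p).choose_spec
  chart_mem_atlas _ := mem_range_self _

instance : IsManifold 𝓘(ℝ, Fin n → ℝ) ∞ (RealProjectiveSpace n) := by
  apply isManifold_of_contDiffOn
  rintro _ _ ⟨i, rfl⟩ ⟨j, rfl⟩
  have hlift : ∀ l : Fin (n + 1), ContDiff ℝ ∞ fun y : Fin n → ℝ => (affineLift i y).1 l := by
    intro l
    rcases Fin.eq_self_or_eq_succAbove i l with rfl | ⟨k, rfl⟩
    · simp only [affineLift, Fin.insertNth_apply_same]; exact contDiff_const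
    · simp only [affineLift, Fin.insertNth_apply_succAbove]; exact contDiff_apply ℝ ℝ k
  refine contDiffOn_pi.mpr fun k => ?_
  refine ContDiffOn.div (hlift _).contDiffOn (hlift j).contDiffOn ?_
  intro y hy
  have h2 : mk (affineLift i y) ∈ affineOpen j := by
    have h1 : y ∈ (affineChart i).symm.source ∧ mk (affineLift i y) ∈ affineOpen j := hy.1
    exact h1.2
  simpa using h2

end RealProjectiveSpace

/-! ### Connected components and diffeomorphism type -/

/-- The set of connected components of a subset `S` of a topological space, as subsets of it. -/
def componentsOf {X : Type*} [TopologicalSpace X] (S : Set X) : Set (Set X) :=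
  {C | ∃ x ∈ S, C = connectedComponentIn S x}

/-- The subset `S` of the normed space `V` is a smooth submanifold diffeomorphic to the manifold
`M` (without boundary): it is the image of a smooth embedding of `M`, that is, of a smooth
immersion which is a homeomorphism onto its image. -/
def IsDiffeomorphicTo {E H : Type*} [NormedAddCommGroup E] [NormedSpace ℝ E] [TopologicalSpace H]
    (I : ModelWithCorners ℝ E H) (M : Type*) [TopologicalSpace M] [ChartedSpace H M]
    {V : Type*} [NormedAddCommGroup V] [NormedSpace ℝ V] (S : Set V) : Prop :=
  ∃ f : M → V, ContMDiff I 𝓘(ℝ, V) ∞ f ∧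
    (∀ p : M, Function.Injective (mfderiv I 𝓘(ℝ, V) f p)) ∧ IsEmbedding f ∧ range f = S

/-- A subset of a Euclidean space is diffeomorphic to the two-sphere. -/
def IsDiffeomorphicToS2 {V : Type*} [NormedAddCommGroup V] [NormedSpace ℝ V] (S : Set V) : Prop :=
  IsDiffeomorphicTo (𝓡 2) S2 S

/-- A subset of a Euclidean space is diffeomorphic to real projective three-space. -/
def IsDiffeomorphicToRP3 {V : Type*} [NormedAddCommGroup V] [NormedSpace ℝ V] (S : Set V) : Prop :=
  IsDiffeomorphicTo 𝓘(ℝ, Fin 3 → ℝ) (RealProjectiveSpace 3) S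

/-- The inclusion of a power of the two-sphere in the power of Euclidean three-space; subsets of
the former are regarded as subsets of the latter to speak of their smooth structure. -/
def powerIncl {ι : Type*} (x : ι → S2) : ι → E3 := fun i => (x i : E3)

/-- The inclusion of `S² × S²` in `ℝ³ × ℝ³`. -/
def pairIncl (p : S2 × S2) : E3 × E3 := ((p.1 : E3), (p.2 : E3))

/-- The pairs of points of the two-sphere at angle (spherical distance) `θ` from each other. -/
noncomputable def pairsAtAngle (θ : ℝ) : Set (S2 × S2) :=
  {p | InnerProductGeometry.angle (p.1 : E3) (p.2 : E3) = θ}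

/-- The colourings of the standard diagram of the figure-eight knot by the two-sphere, recorded by
the colours `(a, b)` of its first two arcs. -/
def figureEightPair (x : colouringSpace S2 figureEightDiagram) : S2 × S2 := (x.1 0, x.1 1)

/-! Write `i_a` for the geodesic symmetry at `a`. Braids act on tuples by restrictions of smooth
ambient maps, so conjugation moves a fixed set by a smooth ambient map with a smooth inverse.
Stabilization adds a last coordinate that the fixed-point equation forces to repeat the previous
one, because `y ◃ x = y` only for `x = y`. Hence Markov equivalent braids have smoothly equivalent
invariant spaces (`MarkovEquivalent.smoothEquiv`), and one braid suffices.

For the three-strand braid, and likewise for the four-arc diagram, all colours are determined by two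
of them, `a` and `b`, subject to the single relation `i_b i_a i_b a = i_a b`. On the great circle
through `a` (angle `0`) and `b` (angle `θ`) the two sides lie at angles `4θ` and `-θ`, so the
relation says `5θ ≡ 0` modulo `2π`, that is `θ = 0, 2π/5, 4π/5`. The algebraic form is
`S2.pentagon_iff`: with `c = ⟨a, b⟩`, the relation factors as `(4c² + 2c - 1)(a - (2c - 1)b) = 0`.

Angle `0` gives the diagonal, a sphere. At a fixed angle strictly between `0` and `π`, Gram–Schmidt
turns pairs into orthonormal two-frames (`smoothEquiv_orthonormalPairs_pairsAtAngle`). These form a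
copy of `SO(3)`, parametrized by quaternions up to scale: `projectiveFrame` is onto by
`exists_quaternion_conj`, and injective and immersive because `frameMatrix` recovers the homogeneous
coordinates. The three pieces are closed, disjoint and connected, so they are the components. -/

/-! ### Subsets of normed spaces up to diffeomorphism -/

/-- Two subsets of normed spaces are smoothly equivalent if smooth maps between the ambient spaces
restrict to mutually inverse bijections between them. -/
def SmoothEquiv {V W : Type*} [NormedAddCommGroup V] [NormedSpace ℝ V] [NormedAddCommGroup W]
    [NormedSpace ℝ W] (A : Set V) (B : Set W) : Prop :=
  ∃ (F : V → W) (G : W → V), ContDiff ℝ ∞ F ∧ ContDiff ℝ ∞ G ∧ MapsTo F A B ∧ MapsTo G B A ∧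
    LeftInvOn G F A ∧ LeftInvOn F G B

section

variable {V W X : Type*} [NormedAddCommGroup V] [NormedSpace ℝ V] [NormedAddCommGroup W]
  [NormedSpace ℝ W] [NormedAddCommGroup X] [NormedSpace ℝ X]

theorem SmoothEquiv.refl (A : Set V) : SmoothEquiv A A :=
  ⟨id, id, contDiff_id, contDiff_id, mapsTo_id A, mapsTo_id A, fun _ _ => rfl, fun _ _ => rfl⟩

theorem SmoothEquiv.symm {A : Set V} {B : Set W} : SmoothEquiv A B → SmoothEquiv B A :=
  fun ⟨F, G, hF, hG, h1, h2, h3, h4⟩ => ⟨G, F, hG, hF, h2, h1, h4, h3⟩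

theorem SmoothEquiv.trans {A : Set V} {B : Set W} {C : Set X} :
    SmoothEquiv A B → SmoothEquiv B C → SmoothEquiv A C := by
  rintro ⟨F, G, hF, hG, h1, h2, h3, h4⟩ ⟨F', G', hF', hG', h1', h2', h3', h4'⟩
  refine ⟨F' ∘ F, G ∘ G', hF'.comp hF, hG.comp hG', h1'.comp h1, h2.comp h2', ?_, ?_⟩
  · intro x hx
    simp only [Function.comp_apply]
    rw [h3' (h1 hx), h3 hx]
  · intro x hx
    simp only [Function.comp_apply]
    rw [h4 (h2' hx), h4' hx]

theorem injective_mfderiv_of_comp {E H M : Type*} [NormedAddCommGroup E] [NormedSpace ℝ E]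
    [TopologicalSpace H] {I : ModelWithCorners ℝ E H} [TopologicalSpace M] [ChartedSpace H M]
    {f : M → V} {G : V → W} {p : M} (hf : MDifferentiableAt I 𝓘(ℝ, V) f p)
    (hG : DifferentiableAt ℝ G (f p))
    (h : Function.Injective (mfderiv I 𝓘(ℝ, W) (G ∘ f) p)) :
    Function.Injective (mfderiv I 𝓘(ℝ, V) f p) := by
  rw [mfderiv_comp p hG.mdifferentiableAt hf] at h
  exact Function.Injective.of_comp h

/-- Since `G ∘ F ∘ f = f`, both the immersion and the embedding property of `f` pass back to `F ∘
f`. Nothing is needed of `G ∘ F` off `S`. -/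
theorem IsDiffeomorphicTo.image {E H : Type*} [NormedAddCommGroup E] [NormedSpace ℝ E]
    [TopologicalSpace H] {I : ModelWithCorners ℝ E H} {M : Type*} [TopologicalSpace M]
    [ChartedSpace H M] {S : Set V} {F : V → W} {G : W → V}
    (hF : ContDiff ℝ ∞ F) (hG : ContDiff ℝ ∞ G) (hGF : LeftInvOn G F S)
    (h : IsDiffeomorphicTo I M S) : IsDiffeomorphicTo I M (F '' S) := by
  obtain ⟨f, hf, hinj, hemb, rfl⟩ := h
  have hcomp : G ∘ (F ∘ f) = f := funext fun p => hGF (mem_range_self p)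
  have hFf : ContMDiff I 𝓘(ℝ, W) ∞ (F ∘ f) := hF.contMDiff.comp hf
  refine ⟨F ∘ f, hFf, fun p => ?_, ?_, range_comp F f⟩
  · refine injective_mfderiv_of_comp (G := G) (hFf.mdifferentiable (by simp) p)
      (hG.differentiable (by simp) _) ?_
    rw [hcomp]
    exact hinj p
  · exact IsEmbedding.of_comp hFf.continuous hG.continuous (hcomp.symm ▸ hemb)

end

/-! ### Connected components of subsets -/

theorem componentsOf_image {X Y : Type*} [TopologicalSpace X] [TopologicalSpace Y] {S : Set X}
    {F : X → Y} {G : Y → X} (hF : ContinuousOn F S) (hG : ContinuousOn G (F '' S))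
    (h : LeftInvOn G F S) : componentsOf (F '' S) = image F '' componentsOf S := by
  have key : ∀ x ∈ S, connectedComponentIn (F '' S) (F x) = F '' connectedComponentIn S x := by
    intro x hx
    apply Subset.antisymm
    · have hsub := connectedComponentIn_subset (F '' S) (F x)
      have h1 : G '' connectedComponentIn (F '' S) (F x) ⊆ connectedComponentIn S x := by
        refine IsPreconnected.subset_connectedComponentIn
          (isPreconnected_connectedComponentIn.image G (hG.mono hsub)) ?_ ?_
        · exact ⟨F x, mem_connectedComponentIn (mem_image_of_mem F hx), h hx⟩
        · rintro _ ⟨y, hy, rfl⟩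
          obtain ⟨z, hz, rfl⟩ := hsub hy
          rwa [h hz]
      intro y hy
      obtain ⟨z, hz, rfl⟩ := hsub hy
      exact ⟨z, h hz ▸ h1 (mem_image_of_mem G hy), rfl⟩
    · refine IsPreconnected.subset_connectedComponentIn
          (isPreconnected_connectedComponentIn.image F
            (hF.mono (connectedComponentIn_subset S x))) ?_ ?_
      · exact mem_image_of_mem F (mem_connectedComponentIn hx)
      · exact image_mono (connectedComponentIn_subset S x)
  ext C
  constructor
  · rintro ⟨_, ⟨x, hx, rfl⟩, rfl⟩
    exact ⟨_, ⟨x, hx, rfl⟩, (key x hx).symm⟩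
  · rintro ⟨_, ⟨x, hx, rfl⟩, rfl⟩
    exact ⟨F x, mem_image_of_mem F hx, (key x hx).symm⟩

/-- A preconnected subset of the union of two disjoint closed sets cannot meet both. -/
theorem connectedComponentIn_union_eq {X : Type*} [TopologicalSpace X] {A B : Set X}
    (hA : IsClosed A) (hB : IsClosed B) (hAB : Disjoint A B) (hc : IsPreconnected A) {x : X}
    (hx : x ∈ A) : connectedComponentIn (A ∪ B) x = A := by
  apply Subset.antisymm
  · have hxmem := mem_connectedComponentIn (mem_union_left B hx)
    intro y hy
    by_contra hyA
    have hyB := ((connectedComponentIn_subset (A ∪ B) x) hy).resolve_left hyA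
    obtain ⟨z, -, hz⟩ := isPreconnected_closed_iff.mp
      (isPreconnected_connectedComponentIn (F := A ∪ B) (x := x)) A B hA hB
      (connectedComponentIn_subset _ _) ⟨x, hxmem, hx⟩ ⟨y, hy, hyB⟩
    exact disjoint_left.mp hAB hz.1 hz.2
  · exact hc.subset_connectedComponentIn hx subset_union_left

theorem componentsOf_union_three {X : Type*} [TopologicalSpace X] {A B C : Set X}
    (hA : IsClosed A) (hB : IsClosed B) (hC : IsClosed C) (hAB : Disjoint A B)
    (hAC : Disjoint A C) (hBC : Disjoint B C) (cA : IsConnected A) (cB : IsConnected B)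
    (cC : IsConnected C) : componentsOf (A ∪ B ∪ C) = {A, B, C} := by
  have kA : ∀ x ∈ A, connectedComponentIn (A ∪ B ∪ C) x = A := fun x hx => by
    rw [union_assoc]
    exact connectedComponentIn_union_eq hA (hB.union hC) (hAB.union_right hAC) cA.2 hx
  have kB : ∀ x ∈ B, connectedComponentIn (A ∪ B ∪ C) x = B := fun x hx => by
    rw [union_comm A B, union_assoc]
    exact connectedComponentIn_union_eq hB (hA.union hC) (hAB.symm.union_right hBC) cB.2 hx
  have kC : ∀ x ∈ C, connectedComponentIn (A ∪ B ∪ C) x = C := fun x hx => by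
    rw [union_comm]
    exact connectedComponentIn_union_eq hC (hA.union hB) (hAC.symm.union_right hBC.symm) cC.2 hx
  ext D
  constructor
  · rintro ⟨x, (hx | hx) | hx, rfl⟩
    · simp [kA x hx]
    · simp [kB x hx]
    · simp [kC x hx]
  · rintro (rfl | rfl | rfl)
    · obtain ⟨x, hx⟩ := cA.1
      exact ⟨x, .inl (.inl hx), (kA x hx).symm⟩
    · obtain ⟨x, hx⟩ := cB.1
      exact ⟨x, .inl (.inr hx), (kB x hx).symm⟩
    · obtain ⟨x, hx⟩ := cC.1
      exact ⟨x, .inr hx, (kC x hx).symm⟩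

theorem Topology.IsEmbedding.componentsOf_image {X Y : Type*} [TopologicalSpace X]
    [TopologicalSpace Y] {F : X → Y} (hF : IsEmbedding F) (S : Set X) :
    componentsOf (F '' S) = image F '' componentsOf S := by
  rcases isEmpty_or_nonempty X with hX | hX
  · simp [componentsOf, eq_empty_of_isEmpty S]
  · have hinv : Function.LeftInverse (Function.invFun F) F := Function.leftInverse_invFun hF.injective
    refine _root_.componentsOf_image hF.continuous.continuousOn ?_ (hinv.leftInvOn S)
    -- Continuity of the inverse is tested after composing with `F`, and that composite is the
    -- identity on the image.
    rw [hF.isInducing.continuousOn_iff]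
    refine continuousOn_id.congr ?_
    rintro _ ⟨x, -, rfl⟩
    exact congrArg F (hinv x)

/-! ### Having one spherical and two projective components -/

/-- The set has exactly three components, one of them diffeomorphic to the two-sphere and two
diffeomorphic to real projective three-space. -/
def HasSphereAndTwoProjectiveComponents {V : Type*} [NormedAddCommGroup V] [NormedSpace ℝ V]
    (A : Set V) : Prop :=
  ∃ C₀ C₁ C₂ : Set V, componentsOf A = {C₀, C₁, C₂} ∧ C₀ ≠ C₁ ∧ C₀ ≠ C₂ ∧ C₁ ≠ C₂ ∧
    IsDiffeomorphicToS2 C₀ ∧ IsDiffeomorphicToRP3 C₁ ∧ IsDiffeomorphicToRP3 C₂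

theorem subset_of_mem_componentsOf {X : Type*} [TopologicalSpace X] {S C : Set X}
    (h : C ∈ componentsOf S) : C ⊆ S := by
  obtain ⟨x, -, rfl⟩ := h
  exact connectedComponentIn_subset S x

theorem HasSphereAndTwoProjectiveComponents.of_smoothEquiv {V W : Type*} [NormedAddCommGroup V]
    [NormedSpace ℝ V] [NormedAddCommGroup W] [NormedSpace ℝ W] {A : Set V} {B : Set W}
    (hAB : SmoothEquiv A B) (h : HasSphereAndTwoProjectiveComponents A) :
    HasSphereAndTwoProjectiveComponents B := by
  obtain ⟨F, G, hF, hG, h1, h2, h3, h4⟩ := hAB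
  obtain ⟨C₀, C₁, C₂, hC, n1, n2, n3, d0, d1, d2⟩ := h
  have hB : F '' A = B := by
    apply Subset.antisymm h1.image_subset
    intro y hy
    exact ⟨G y, h2 hy, h4 hy⟩
  have s0 : C₀ ⊆ A := subset_of_mem_componentsOf (hC ▸ by simp)
  have s1 : C₁ ⊆ A := subset_of_mem_componentsOf (hC ▸ by simp)
  have s2 : C₂ ⊆ A := subset_of_mem_componentsOf (hC ▸ by simp)
  have hne : ∀ {C D : Set V}, C ⊆ A → D ⊆ A → C ≠ D → F '' C ≠ F '' D := fun hC hD hCD heq =>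
    hCD ((h3.injOn.image_eq_image_iff hC hD).mp heq)
  refine ⟨F '' C₀, F '' C₁, F '' C₂, ?_, hne s0 s1 n1, hne s0 s2 n2, hne s1 s2 n3,
    d0.image hF hG (h3.mono s0), d1.image hF hG (h3.mono s1),
    d2.image hF hG (h3.mono s2)⟩
  rw [← hB, componentsOf_image hF.continuous.continuousOn hG.continuous.continuousOn h3, hC]
  simp [image_insert_eq]

/-! ### Real projective three-space as the space of orthonormal two-frames -/

namespace RealProjectiveSpace

/-- Projective space is a quotient of the punctured vector space. The index `n + 1` makes that space
at least two-dimensional, hence connected after removing the origin. -/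
theorem isConnected_range_of_continuous {n : ℕ} {Y : Type*} [TopologicalSpace Y]
    {f : RealProjectiveSpace (n + 1) → Y} (hf : Continuous f) : IsConnected (range f) := by
  have h0 : IsConnected ({0}ᶜ : Set (Fin (n + 1 + 1) → ℝ)) := by
    refine isConnected_compl_singleton_of_one_lt_rank ?_ 0
    rw [rank_fin_fun]
    exact_mod_cast (by omega : 1 < n + 1 + 1)
  have : ConnectedSpace {v : Fin (n + 1 + 1) → ℝ // v ≠ 0} :=
    isConnected_iff_connectedSpace.mp h0
  have h1 := isConnected_range (hf.comp isQuotientMap_mk.continuous)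
  rwa [range_comp, mk_surjective.range_eq, image_univ] at h1

instance (n : ℕ) : CompactSpace (RealProjectiveSpace n) := by
  let g : Metric.sphere (0 : Fin (n + 1) → ℝ) 1 → RealProjectiveSpace n := fun v =>
    mk ⟨v, ne_zero_of_mem_unit_sphere v⟩
  have hg : Continuous g :=
    isQuotientMap_mk.continuous.comp (continuous_subtype_val.subtype_mk _)
  have hs : Function.Surjective g := by
    intro p
    obtain ⟨v, rfl⟩ := mk_surjective p
    have hv : ‖v.1‖ ≠ 0 := norm_ne_zero_iff.mpr v.2
    refine ⟨⟨‖v.1‖⁻¹ • v.1, ?_⟩, ?_⟩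
    · rw [mem_sphere_zero_iff_norm, norm_smul, norm_inv, norm_norm, inv_mul_cancel₀ hv]
    · rw [mk_eq_mk_iff]
      exact ⟨‖v.1‖⁻¹, rfl⟩
  rw [← isCompact_univ_iff, ← hs.range_eq]
  exact isCompact_range hg

end RealProjectiveSpace

open RealProjectiveSpace

/-! ### Quaternion parametrization of orthonormal frames -/

/-- The sum of the squares of four real numbers. -/
def sumSq (v : Fin 4 → ℝ) : ℝ := v 0 ^ 2 + v 1 ^ 2 + v 2 ^ 2 + v 3 ^ 2

theorem sumSq_pos {v : Fin 4 → ℝ} (hv : v ≠ 0) : 0 < sumSq v := by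
  obtain ⟨i, hi⟩ := Function.ne_iff.mp hv
  have := sq_pos_of_ne_zero hi
  unfold sumSq
  fin_cases i <;> simp at this <;> positivity

theorem sumSq_ne_zero {v : Fin 4 → ℝ} (hv : v ≠ 0) : sumSq v ≠ 0 := (sumSq_pos hv).ne'

/-- The first two columns of the rotation matrix of the quaternion with coordinates `v`. -/
noncomputable def rotationFrame (v : Fin 4 → ℝ) : E3 × E3 :=
  (sumSq v)⁻¹ •
    (!₂[v 0 ^ 2 + v 1 ^ 2 - v 2 ^ 2 - v 3 ^ 2, 2 * (v 1 * v 2 + v 0 * v 3),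
        2 * (v 1 * v 3 - v 0 * v 2)],
      !₂[2 * (v 1 * v 2 - v 0 * v 3), v 0 ^ 2 - v 1 ^ 2 + v 2 ^ 2 - v 3 ^ 2,
        2 * (v 2 * v 3 + v 0 * v 1)])

theorem rotationFrame_smul {t : ℝ} (ht : t ≠ 0) (v : Fin 4 → ℝ) :
    rotationFrame (t • v) = rotationFrame v := by
  have h : sumSq (t • v) = t ^ 2 * sumSq v := by simp [sumSq]; ring
  unfold rotationFrame
  rw [h, mul_inv, mul_comm, mul_smul]
  congr 1
  rw [inv_smul_eq_iff₀ (pow_ne_zero 2 ht)]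
  ext k <;> fin_cases k <;> simp <;> ring

theorem contDiffAt_rotationFrame {v : Fin 4 → ℝ} (hv : v ≠ 0) :
    ContDiffAt ℝ ∞ rotationFrame v := by
  unfold rotationFrame
  refine ContDiffAt.smul (ContDiffAt.inv ?_ (sumSq_ne_zero hv)) (ContDiff.contDiffAt ?_)
  · unfold sumSq
    fun_prop
  · refine ContDiff.prodMk ?_ ?_ <;>
    · rw [contDiff_euclidean]
      intro k
      fin_cases k <;> simp <;> fun_prop

/-- The symmetric matrix `4 q qᵀ` of a unit quaternion `q`, as a function of the first two columns
of the rotation matrix of `q`. -/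
def frameMatrix (p : E3 × E3) : Matrix (Fin 4) (Fin 4) ℝ :=
  let a := p.1
  let b := p.2
  let c : Fin 3 → ℝ := ![a 1 * b 2 - a 2 * b 1, a 2 * b 0 - a 0 * b 2, a 0 * b 1 - a 1 * b 0]
  !![1 + a 0 + b 1 + c 2, b 2 - c 1, c 0 - a 2, a 1 - b 0;
    b 2 - c 1, 1 + a 0 - b 1 - c 2, b 0 + a 1, c 0 + a 2;
    c 0 - a 2, b 0 + a 1, 1 - a 0 + b 1 - c 2, c 1 + b 2;
    a 1 - b 0, c 0 + a 2, c 1 + b 2, 1 - a 0 - b 1 + c 2]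

/-- The third column of a rotation matrix is the cross product of the other two, and the products
`q_i q_j` are affine-linear in the nine entries. So the frame determines `q` up to sign,
polynomially. -/
theorem frameMatrix_rotationFrame {v : Fin 4 → ℝ} (hv : v ≠ 0) (i j : Fin 4) :
    frameMatrix (rotationFrame v) i j = 4 * v i * v j / sumSq v := by
  have h := sumSq_ne_zero hv
  rw [eq_div_iff h]
  fin_cases i <;> fin_cases j <;> simp [frameMatrix, rotationFrame] <;> field_simp <;>
    (try simp only [sumSq]) <;> ring

theorem contDiff_frameMatrix (i j : Fin 4) : ContDiff ℝ ∞ fun p => frameMatrix p i j := by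
  fin_cases i <;> fin_cases j <;> simp [frameMatrix] <;> fun_prop

/-- The orthonormal two-frames in Euclidean three-space. -/
def orthonormalPairs : Set (E3 × E3) :=
  {p | inner ℝ p.1 p.1 = 1 ∧ inner ℝ p.2 p.2 = 1 ∧ inner ℝ p.1 p.2 = 0}

theorem E3.inner_eq (a b : E3) : inner ℝ a b = a 0 * b 0 + a 1 * b 1 + a 2 * b 2 := by
  simp [PiLp.inner_apply, Fin.sum_univ_three, mul_comm]

theorem rotationFrame_mem {v : Fin 4 → ℝ} (hv : v ≠ 0) : rotationFrame v ∈ orthonormalPairs := by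
  have h := sumSq_ne_zero hv
  refine ⟨?_, ?_, ?_⟩ <;> simp only [E3.inner_eq] <;> simp [rotationFrame] <;> field_simp <;>
    simp only [sumSq] <;> ring

-- An explicit Skolem–Noether argument. For every `x`, the element `x - u₁ x i` intertwines `u₁`
-- with `i`. Applying the same correction with `u₂` and `j` preserves this property, since both
-- pairs anticommute; only nonvanishing has to be arranged.
open Quaternion in
theorem exists_quaternion_conj {u₁ u₂ i j : ℍ[ℝ]} (hu₁ : u₁ * u₁ = -1) (hu₂ : u₂ * u₂ = -1)
    (hu : u₁ * u₂ = -(u₂ * u₁)) (hi : i * i = -1) (hj : j * j = -1) (hij : i * j = -(j * i)) :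
    ∃ q : ℍ[ℝ], q ≠ 0 ∧ u₁ * q = q * i ∧ u₂ * q = q * j := by
  have key : ∀ x : ℍ[ℝ], x = -x → x = 0 := fun x h => by
    have h2 : (2 : ℝ) • x = 0 := by rw [two_smul]; nth_rewrite 1 [h]; simp
    simpa using h2
  have hi0 : i ≠ 0 := by rintro rfl; simp at hi
  have hj0 : j ≠ 0 := by rintro rfl; simp at hj
  obtain ⟨r, hr0, hr⟩ : ∃ r : ℍ[ℝ], r ≠ 0 ∧ u₁ * r = r * i := by
    have hx : ∀ x : ℍ[ℝ], u₁ * (x - u₁ * x * i) = (x - u₁ * x * i) * i := fun x => by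
      have e1 : u₁ * (u₁ * x * i) = -(x * i) := by
        rw [← mul_assoc, ← mul_assoc, hu₁]; simp
      have e2 : u₁ * x * i * i = -(u₁ * x) := by rw [mul_assoc, hi]; simp
      rw [mul_sub, sub_mul, e1, e2]; abel
    -- If `x = 1` gives zero, then `u₁ i = 1` and `x = j` gives `2j`.
    by_cases h1 : 1 - u₁ * 1 * i = 0
    · refine ⟨_, ?_, hx j⟩
      intro h2
      rw [sub_eq_zero, mul_one] at h1
      rw [sub_eq_zero, mul_assoc, ← neg_eq_iff_eq_neg.mpr hij, mul_neg, ← mul_assoc, ← h1,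
        one_mul] at h2
      exact hj0 (key j h2)
    · exact ⟨_, h1, hx 1⟩
  have hy : ∀ y : ℍ[ℝ], y * i = i * y → u₁ * (r * y - u₂ * r * y * j) = (r * y - u₂ * r * y * j) * i ∧
      u₂ * (r * y - u₂ * r * y * j) = (r * y - u₂ * r * y * j) * j := fun y hyi => by
    constructor
    · have e1 : u₁ * (r * y) = r * y * i := by
        rw [← mul_assoc, hr, mul_assoc, mul_assoc, hyi]
      have e2 : u₁ * (u₂ * r * y * j) = -(u₂ * (r * y * i) * j) := by
        rw [← e1]; simp only [← mul_assoc]; rw [hu]; simp only [neg_mul]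
      have e3 : u₂ * r * y * j * i = -(u₂ * (r * y * i) * j) := by
        rw [mul_assoc _ j i, ← neg_eq_iff_eq_neg.mpr hij]; simp only [mul_neg, mul_assoc]
      rw [mul_sub, sub_mul, e1, e2, e3]
    · have e1 : u₂ * (u₂ * r * y * j) = -(r * y * j) := by
        simp only [← mul_assoc]; rw [hu₂]; simp
      have e2 : u₂ * r * y * j * j = -(u₂ * (r * y)) := by
        rw [mul_assoc _ j j, hj]; simp [mul_assoc]
      rw [mul_sub, sub_mul, e1, e2]; abel
  -- If `y = 1` gives zero, then `r = u₂ r j` and `y = i` gives `2 r i`.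
  by_cases h1 : r * 1 - u₂ * r * 1 * j = 0
  · refine ⟨_, ?_, hy i rfl⟩
    intro h2
    rw [sub_eq_zero, mul_one, mul_one] at h1
    rw [sub_eq_zero, mul_assoc _ i j, hij, mul_neg, ← mul_assoc, ← h1] at h2
    exact mul_ne_zero hr0 hi0 (key _ h2)
  · exact ⟨_, h1, hy 1 (by simp)⟩

-- Read as imaginary quaternions, orthonormal vectors are anticommuting square roots of `-1`. A
-- quaternion `q` conjugating the standard `i, j` to them has them as the first two columns of its
-- rotation matrix.
open Quaternion in
theorem exists_rotationFrame_eq {p : E3 × E3} (hp : p ∈ orthonormalPairs) :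
    ∃ v : Fin 4 → ℝ, v ≠ 0 ∧ rotationFrame v = p := by
  obtain ⟨a, b⟩ := p
  obtain ⟨ha, hb, hab⟩ := hp
  simp only [E3.inner_eq] at ha hb hab
  have hex : ∀ x y z : ℝ, ∃ u : ℍ[ℝ], u.re = 0 ∧ u.imI = x ∧ u.imJ = y ∧ u.imK = z :=
    fun x y z => ⟨⟨0, x, y, z⟩, rfl, rfl, rfl, rfl⟩
  obtain ⟨u, u0, u1, u2, u3⟩ := hex (a 0) (a 1) (a 2)
  obtain ⟨w, w0, w1, w2, w3⟩ := hex (b 0) (b 1) (b 2)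
  obtain ⟨i, i0, i1, i2, i3⟩ := hex 1 0 0
  obtain ⟨j, j0, j1, j2, j3⟩ := hex 0 1 0
  obtain ⟨q, hq0, h1, h2⟩ := exists_quaternion_conj (u₁ := u) (u₂ := w) (i := i) (j := j)
    (by ext <;> simp [u0, u1, u2, u3] <;> linarith)
    (by ext <;> simp [w0, w1, w2, w3] <;> linarith)
    (by ext <;> simp [u0, u1, u2, u3, w0, w1, w2, w3] <;> linarith)
    (by ext <;> simp [i0, i1, i2, i3]) (by ext <;> simp [j0, j1, j2, j3])
    (by ext <;> simp [i0, i1, i2, i3, j0, j1, j2, j3])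
  have hv : (![q.re, q.imI, q.imJ, q.imK] : Fin 4 → ℝ) ≠ 0 := by
    intro h
    apply hq0
    ext
    · exact congrFun h 0
    · exact congrFun h 1
    · exact congrFun h 2
    · exact congrFun h 3
  have hs : sumSq ![q.re, q.imI, q.imJ, q.imK] = normSq q := by
    simp [sumSq, normSq_def']
  -- Multiplying by `star q` replaces the inverse of `q`; the coordinates of the right side are the
  -- unnormalized column in `rotationFrame`.
  have h1' : u * ((normSq q : ℝ) : ℍ[ℝ]) = q * i * star q := by
    rw [← h1, ← self_mul_star, mul_assoc]
  have h2' : w * ((normSq q : ℝ) : ℍ[ℝ]) = q * j * star q := by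
    rw [← h2, ← self_mul_star, mul_assoc]
  refine ⟨_, hv, ?_⟩
  have hs0 := sumSq_ne_zero hv
  unfold rotationFrame
  rw [inv_smul_eq_iff₀ hs0, hs]
  rw [Quaternion.ext_iff] at h1' h2'
  obtain ⟨-, x1, x2, x3⟩ := h1'
  obtain ⟨-, y1, y2, y3⟩ := h2'
  simp [u0, u1, u2, u3, w0, w1, w2, w3, i0, i1, i2, i3, j0, j1, j2, j3] at x1 x2 x3 y1 y2 y3
  ext k <;> fin_cases k <;> simp <;> linarith

/-- The orthonormal frame attached to a point of real projective three-space. -/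
noncomputable def projectiveFrame (p : RealProjectiveSpace 3) : E3 × E3 :=
  Projectivization.lift (K := ℝ) (V := Fin 4 → ℝ) (fun v => rotationFrame v.1) (by
    rintro ⟨a, ha⟩ ⟨b, hb⟩ t h
    have h' : a = t • b := h
    have ht : t ≠ 0 := by rintro rfl; exact ha (by simpa using h')
    subst h'
    exact rotationFrame_smul ht b) p

theorem projectiveFrame_mk (v : {v : Fin 4 → ℝ // v ≠ 0}) :
    projectiveFrame (RealProjectiveSpace.mk v) = rotationFrame v.1 := rfl

theorem range_projectiveFrame : range projectiveFrame = orthonormalPairs := by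
  apply Subset.antisymm
  · rintro _ ⟨p, rfl⟩
    obtain ⟨v, rfl⟩ := mk_surjective p
    exact rotationFrame_mem v.2
  · intro p hp
    obtain ⟨v, hv, rfl⟩ := exists_rotationFrame_eq hp
    exact ⟨RealProjectiveSpace.mk ⟨v, hv⟩, rfl⟩

/-! ### Recovering affine coordinates from a frame -/

theorem frameMatrix_projectiveFrame_ne_zero {i : Fin 4} {p : RealProjectiveSpace 3}
    (hp : p ∈ affineOpen i) : frameMatrix (projectiveFrame p) i i ≠ 0 := by
  obtain ⟨v, rfl⟩ := mk_surjective p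
  rw [mk_mem_affineOpen] at hp
  rw [projectiveFrame_mk, frameMatrix_rotationFrame v.2]
  have := sumSq_ne_zero v.2
  positivity

/-- Dividing column `i` of a multiple of `q qᵀ` by its diagonal entry gives the coordinates of the
`i`-th affine chart. This local inverse, smooth near the frame, yields both injectivity and
immersivity. -/
theorem frameMatrix_projectiveFrame_div {i : Fin 4} {p : RealProjectiveSpace 3}
    (hp : p ∈ affineOpen i) (j : Fin 4) :
    frameMatrix (projectiveFrame p) j i / frameMatrix (projectiveFrame p) i i = ratio j i p := by
  obtain ⟨v, rfl⟩ := mk_surjective p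
  rw [mk_mem_affineOpen] at hp
  rw [projectiveFrame_mk, frameMatrix_rotationFrame v.2, frameMatrix_rotationFrame v.2, ratio_mk]
  have := sumSq_ne_zero v.2
  field_simp

theorem projectiveFrame_injective : Function.Injective projectiveFrame := by
  intro p q hpq
  obtain ⟨i, hi⟩ := exists_mem_affineOpen p
  have hq : q ∈ affineOpen i := by
    -- A vanishing `i`-th coordinate of `q` would make the diagonal entry zero, but equal frames
    -- have equal matrices.
    by_contra hq
    have h := frameMatrix_projectiveFrame_ne_zero hi
    obtain ⟨v, rfl⟩ := mk_surjective q
    rw [mk_mem_affineOpen, not_not] at hq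
    rw [hpq, projectiveFrame_mk, frameMatrix_rotationFrame v.2, hq] at h
    simp at h
  apply (affineChart i).injOn hi hq
  funext k
  change ratio _ i p = ratio _ i q
  rw [← frameMatrix_projectiveFrame_div hi, ← frameMatrix_projectiveFrame_div hq, hpq]

theorem contMDiff_projectiveFrame :
    ContMDiff 𝓘(ℝ, Fin 3 → ℝ) 𝓘(ℝ, E3 × E3) ∞ projectiveFrame := by
  intro p
  obtain ⟨i, hi⟩ : ∃ i, chartAt (Fin 3 → ℝ) p = affineChart i := ⟨_, rfl⟩
  have hp : p ∈ (affineChart i).source := hi ▸ mem_chart_source _ p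
  have hchart : ContMDiffAt 𝓘(ℝ, Fin 3 → ℝ) 𝓘(ℝ, Fin 3 → ℝ) ∞ (affineChart i) p := by
    rw [← hi]
    exact contMDiffOn_chart.contMDiffAt (chart_source_mem_nhds _ p)
  have hlift : ContDiff ℝ ∞ fun y : Fin 3 → ℝ => (affineLift i y).1 := by
    refine contDiff_pi.mpr fun l => ?_
    rcases Fin.eq_self_or_eq_succAbove i l with rfl | ⟨k, rfl⟩
    · simp only [affineLift, Fin.insertNth_apply_same]; exact contDiff_const
    · simp only [affineLift, Fin.insertNth_apply_succAbove]; exact contDiff_apply ℝ ℝ k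
  have hF : ContDiff ℝ ∞ fun y : Fin 3 → ℝ => rotationFrame (affineLift i y).1 :=
    contDiff_iff_contDiffAt.mpr fun y =>
      ContDiffAt.comp (g := rotationFrame) y (contDiffAt_rotationFrame (affineLift i y).2) hlift.contDiffAt
  refine (hF.contMDiff.contMDiffAt.comp p hchart).congr_of_eventuallyEq ?_
  filter_upwards [(affineChart i).open_source.mem_nhds hp] with q hq
  exact congrArg projectiveFrame ((affineChart i).left_inv hq).symm

/-- Followed by the quotients of matrix entries, the map becomes the chart at `p`, whose derivative
is invertible. -/
theorem injective_mfderiv_projectiveFrame (p : RealProjectiveSpace 3) :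
    Function.Injective (mfderiv 𝓘(ℝ, Fin 3 → ℝ) 𝓘(ℝ, E3 × E3) projectiveFrame p) := by
  obtain ⟨i, hi⟩ : ∃ i, chartAt (Fin 3 → ℝ) p = affineChart i := ⟨_, rfl⟩
  have hp : p ∈ (affineChart i).source := hi ▸ mem_chart_source _ p
  refine injective_mfderiv_of_comp (W := Fin 3 → ℝ) (G := fun x k =>
    frameMatrix x (i.succAbove k) i / frameMatrix x i i)
    (contMDiff_projectiveFrame.mdifferentiable (by simp) p) ?_ ?_
  · refine differentiableAt_pi.mpr fun k => ?_
    have h : ∀ j, DifferentiableAt ℝ (fun x => frameMatrix x j i) (projectiveFrame p) := fun j =>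
      (contDiff_frameMatrix j i).differentiable (by simp) _
    exact (h _).mul ((h i).inv (frameMatrix_projectiveFrame_ne_zero hp))
  · have heq : (fun x k => frameMatrix x (i.succAbove k) i / frameMatrix x i i) ∘ projectiveFrame
        =ᶠ[𝓝 p] extChartAt 𝓘(ℝ, Fin 3 → ℝ) p := by
      filter_upwards [(affineChart i).open_source.mem_nhds hp] with q hq
      rw [extChartAt_coe, hi]
      funext k
      exact frameMatrix_projectiveFrame_div hq _
    rw [heq.mfderiv_eq]
    exact (isInvertible_mfderiv_extChartAt (mem_extChartAt_source p)).injective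

/-- The topological embedding is automatic: a continuous injection from a compact space to a
Hausdorff one is closed. -/
theorem isDiffeomorphicToRP3_orthonormalPairs : IsDiffeomorphicToRP3 orthonormalPairs :=
  ⟨projectiveFrame, contMDiff_projectiveFrame, injective_mfderiv_projectiveFrame,
    (contMDiff_projectiveFrame.continuous.isClosedEmbedding projectiveFrame_injective).isEmbedding,
    range_projectiveFrame⟩

theorem isConnected_orthonormalPairs : IsConnected orthonormalPairs :=
  range_projectiveFrame ▸ isConnected_range_of_continuous contMDiff_projectiveFrame.continuous

/-! ### The relation satisfied by the first two colours -/

theorem S2.act_def (b a : S2) : b ◃ a = S2.sym b a := rfl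

theorem S2.invAct_def (b a : S2) : b ◃⁻¹ a = S2.sym b a := rfl

/-- The conjugation rule `i_{i_a b} = i_a i_b i_a` rewrites symmetries at derived points as words in
symmetries at the original ones. -/
theorem S2.sym_sym_apply (a b x : S2) :
    S2.sym (S2.sym a b) x = S2.sym a (S2.sym b (S2.sym a x)) := by
  rw [S2.sym_distrib, S2.sym_sym]

theorem S2.pentagon_iff (a b : S2) :
    S2.sym b (S2.sym a (S2.sym b a)) = S2.sym a b ↔
      a = b ∨ 4 * inner ℝ (a : E3) (b : E3) ^ 2 + 2 * inner ℝ (a : E3) (b : E3) - 1 = 0 := by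
  have ha := S2.inner_self a
  have hb := S2.inner_self b
  have hba := real_inner_comm (a : E3) (b : E3)
  have e1 : (S2.sym b (S2.sym a (S2.sym b a)) : E3) =
      (8 * inner ℝ (a : E3) (b : E3) ^ 3 - 4 * inner ℝ (a : E3) (b : E3)) • (b : E3) -
        (4 * inner ℝ (a : E3) (b : E3) ^ 2 - 1) • (a : E3) := by
    simp only [S2.coe_sym, inner_sub_left, real_inner_smul_left, ha, hb, hba]
    module
  have e2 : (S2.sym a b : E3) = (2 * inner ℝ (a : E3) (b : E3)) • (a : E3) - (b : E3) := by
    rw [S2.coe_sym, hba]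
  generalize hc : inner ℝ (a : E3) (b : E3) = c at *
  constructor
  · intro h
    have h' := congrArg Subtype.val h
    rw [e1, e2] at h'
    -- The coefficient of `b` factors: `8c³ - 4c + 1 = (2c - 1)(4c² + 2c - 1)`.
    have h2 : (4 * c ^ 2 + 2 * c - 1) • ((a : E3) - (2 * c - 1) • (b : E3)) = 0 := by
      linear_combination (norm := module) (-1 : ℝ) • h'
    rcases smul_eq_zero.mp h2 with h3 | h3
    · exact Or.inr h3
    · left
      -- Pairing `a = (2c - 1) b` with `b` gives `c = 2c - 1`, so `c = 1` and `a = b`.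
      have h4 : inner ℝ ((a : E3) - (2 * c - 1) • (b : E3)) (b : E3) = 0 := by simp [h3]
      rw [inner_sub_left, real_inner_smul_left, hb, hc] at h4
      have h5 : c = 1 := by linarith
      rw [h5, sub_eq_zero] at h3
      ext1
      rw [h3]
      module
  · rintro (rfl | h)
    · simp only [S2.sym_self]
    · ext1
      rw [e1, e2]
      linear_combination (norm := module) ((2 * c - 1) * h) • (b : E3) - h • (a : E3)

theorem mem_pairsAtAngle_iff {θ : ℝ} (h0 : 0 ≤ θ) (h1 : θ ≤ Real.pi) (p : S2 × S2) :
    p ∈ pairsAtAngle θ ↔ inner ℝ (p.1 : E3) (p.2 : E3) = Real.cos θ := by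
  have h : Real.cos (InnerProductGeometry.angle (p.1 : E3) (p.2 : E3)) =
      inner ℝ (p.1 : E3) (p.2 : E3) := by simp [InnerProductGeometry.cos_angle]
  rw [← h]
  exact (Real.injOn_cos.eq_iff ⟨InnerProductGeometry.angle_nonneg _ _,
    InnerProductGeometry.angle_le_pi _ _⟩ ⟨h0, h1⟩).symm

theorem cos_two_pi_div_five : Real.cos (2 * Real.pi / 5) = (√5 - 1) / 4 := by
  have h5 : (√5) ^ 2 = 5 := Real.sq_sqrt (by norm_num)
  rw [mul_div_assoc, Real.cos_two_mul, Real.cos_pi_div_five]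
  linear_combination h5 / 8

theorem cos_four_pi_div_five : Real.cos (4 * Real.pi / 5) = -(1 + √5) / 4 := by
  rw [show 4 * Real.pi / 5 = Real.pi - Real.pi / 5 by ring, Real.cos_pi_sub,
    Real.cos_pi_div_five, neg_div]

theorem mem_pairsAtAngle_two_pi_div_five (p : S2 × S2) : p ∈ pairsAtAngle (2 * Real.pi / 5) ↔
    inner ℝ (p.1 : E3) (p.2 : E3) = (√5 - 1) / 4 := by
  rw [← cos_two_pi_div_five]
  apply mem_pairsAtAngle_iff <;> linarith [Real.pi_pos]

theorem mem_pairsAtAngle_four_pi_div_five (p : S2 × S2) : p ∈ pairsAtAngle (4 * Real.pi / 5) ↔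
    inner ℝ (p.1 : E3) (p.2 : E3) = -(1 + √5) / 4 := by
  rw [← cos_four_pi_div_five]
  apply mem_pairsAtAngle_iff <;> linarith [Real.pi_pos]

/-- The pairs of points of the two-sphere at angle `0`, `2π/5` or `4π/5`. -/
def pentagonPairs : Set (S2 × S2) :=
  diagonal S2 ∪ pairsAtAngle (2 * Real.pi / 5) ∪ pairsAtAngle (4 * Real.pi / 5)

theorem mem_pentagonPairs_iff (a b : S2) :
    (a, b) ∈ pentagonPairs ↔ S2.sym b (S2.sym a (S2.sym b a)) = S2.sym a b := by
  have h5 : (√5) ^ 2 = 5 := Real.sq_sqrt (by norm_num)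
  rw [S2.pentagon_iff, pentagonPairs, mem_union, mem_union, mem_diagonal_iff,
    mem_pairsAtAngle_two_pi_div_five, mem_pairsAtAngle_four_pi_div_five, or_assoc]
  refine or_congr_right ?_
  generalize inner ℝ (a : E3) (b : E3) = c
  have h : 4 * c ^ 2 + 2 * c - 1 = 4 * ((c - (√5 - 1) / 4) * (c - -(1 + √5) / 4)) := by
    linear_combination h5 / 4
  rw [h]
  simp [sub_eq_zero]

/-- The quandle relation is not visibly symmetric, but its inner product form is. The braid produces
it with the two colours exchanged. -/
theorem swap_mem_pentagonPairs {a b : S2} (h : (a, b) ∈ pentagonPairs) :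
    (b, a) ∈ pentagonPairs := by
  rw [mem_pentagonPairs_iff, S2.pentagon_iff] at *
  rwa [real_inner_comm, eq_comm]

/-! ### Colourings of the standard diagram -/

/-- The first two crossings express colours `2` and `3` through `0` and `1`; the third then becomes
the pentagon relation, and the fourth is a consequence. -/
theorem mem_colouringSpace_figureEightDiagram (x : Fin 4 → S2) :
    x ∈ colouringSpace S2 figureEightDiagram ↔
      (x 0, x 1) ∈ pentagonPairs ∧ x 2 = S2.sym (x 0) (x 1) ∧
        x 3 = S2.sym (x 0) (S2.sym (x 1) (x 0)) := by
  have h : x ∈ colouringSpace S2 figureEightDiagram ↔ x 2 = S2.sym (x 0) (x 1) ∧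
      x 0 = S2.sym (x 2) (x 3) ∧ x 2 = S2.sym (x 1) (x 3) ∧ x 0 = S2.sym (x 3) (x 1) := by
    simp [colouringSpace, figureEightDiagram, S2.act_def]
  rw [h, mem_pentagonPairs_iff]
  constructor
  · rintro ⟨h1, h2, h3, -⟩
    have h4 : x 3 = S2.sym (x 0) (S2.sym (x 1) (x 0)) := by
      rw [← S2.sym_sym (x 2) (x 3), ← h2, h1, S2.sym_sym_apply, S2.sym_self]
    refine ⟨?_, h1, h4⟩
    rw [← h1, h3, h4]
  · rintro ⟨h1, h2, h3⟩
    refine ⟨h2, ?_, ?_, ?_⟩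
    · rw [h2, h3, S2.sym_sym_apply, S2.sym_sym, S2.sym_sym, S2.sym_self]
    · rw [h2, h3, h1]
    · rw [h3, S2.sym_sym_apply, S2.sym_sym_apply, ← h1, S2.sym_sym, S2.sym_sym, S2.sym_sym,
        S2.sym_self]

/-- The colours of the four arcs of the standard diagram determined by those of the first two. -/
noncomputable def extendColouring (p : S2 × S2) : Fin 4 → S2 :=
  ![p.1, p.2, S2.sym p.1 p.2, S2.sym p.1 (S2.sym p.2 p.1)]

theorem range_figureEightPair : range figureEightPair = pentagonPairs := by
  apply Subset.antisymm
  · rintro _ ⟨x, rfl⟩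
    exact ((mem_colouringSpace_figureEightDiagram _).mp x.2).1
  · rintro ⟨a, b⟩ h
    have hx : extendColouring (a, b) ∈ colouringSpace S2 figureEightDiagram := by
      rw [mem_colouringSpace_figureEightDiagram]
      simpa [extendColouring] using h
    exact ⟨⟨_, hx⟩, rfl⟩

theorem S2.continuous_sym {X : Type*} [TopologicalSpace X] {f g : X → S2} (hf : Continuous f)
    (hg : Continuous g) : Continuous fun x => S2.sym (f x) (g x) := by
  refine Continuous.subtype_mk ?_ _
  fun_prop

theorem continuous_extendColouring : Continuous extendColouring :=
  continuous_pi (Fin.forall_fin_succ.mpr ⟨continuous_fst, Fin.forall_fin_succ.mpr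
    ⟨continuous_snd, Fin.forall_fin_two.mpr ⟨S2.continuous_sym continuous_fst continuous_snd,
      S2.continuous_sym continuous_fst (S2.continuous_sym continuous_snd continuous_fst)⟩⟩⟩)

theorem extendColouring_figureEightPair (x : colouringSpace S2 figureEightDiagram) :
    extendColouring (figureEightPair x) = x := by
  obtain ⟨-, h2, h3⟩ := (mem_colouringSpace_figureEightDiagram _).mp x.2
  funext k
  fin_cases k
  · rfl
  · rfl
  · exact h2.symm
  · exact h3.symm

theorem isEmbedding_figureEightPair : IsEmbedding figureEightPair := by
  have hf : Continuous figureEightPair :=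
    ((continuous_apply 0).comp continuous_subtype_val).prodMk
      ((continuous_apply 1).comp continuous_subtype_val)
  refine IsEmbedding.of_comp hf continuous_extendColouring ?_
  rw [show extendColouring ∘ figureEightPair = Subtype.val from
    funext extendColouring_figureEightPair]
  exact IsEmbedding.subtypeVal

/-! ### The components of the space of pairs -/

theorem isClosed_pairsAtAngle {θ : ℝ} (h0 : 0 ≤ θ) (h1 : θ ≤ Real.pi) :
    IsClosed (pairsAtAngle θ) := by
  have : pairsAtAngle θ = {p : S2 × S2 | inner ℝ (p.1 : E3) (p.2 : E3) = Real.cos θ} := by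
    ext p
    exact mem_pairsAtAngle_iff h0 h1 p
  rw [this]
  exact isClosed_eq (by fun_prop) continuous_const

theorem isEmbedding_pairIncl : IsEmbedding pairIncl :=
  IsEmbedding.subtypeVal.prodMap IsEmbedding.subtypeVal

theorem isEmbedding_powerIncl (ι : Type*) : IsEmbedding (powerIncl (ι := ι)) :=
  IsEmbedding.piMap fun _ => IsEmbedding.subtypeVal

/-- Gram–Schmidt at a fixed angle is linear in the pair and invertible because `sin θ ≠ 0`. -/
theorem smoothEquiv_orthonormalPairs_pairsAtAngle {θ : ℝ} (h0 : 0 < θ) (h1 : θ < Real.pi) :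
    SmoothEquiv orthonormalPairs (pairIncl '' pairsAtAngle θ) := by
  have hs : Real.sin θ ≠ 0 := (Real.sin_pos_of_pos_of_lt_pi h0 h1).ne'
  have hcs := Real.sin_sq_add_cos_sq θ
  refine ⟨fun p => (p.1, Real.cos θ • p.1 + Real.sin θ • p.2),
    fun p => (p.1, (Real.sin θ)⁻¹ • (p.2 - Real.cos θ • p.1)), by fun_prop, by fun_prop,
    ?_, ?_, ?_, ?_⟩
  · rintro ⟨a, b⟩ ⟨haa, hbb, hab⟩
    dsimp only at *
    have hba : inner ℝ b a = 0 := by rw [real_inner_comm, hab]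
    refine ⟨(⟨a, ?_⟩, ⟨Real.cos θ • a + Real.sin θ • b, ?_⟩), ?_, rfl⟩
    · rw [mem_sphere_zero_iff_norm, ← sq_eq_sq₀ (norm_nonneg _) zero_le_one,
        ← real_inner_self_eq_norm_sq, haa, one_pow]
    · rw [mem_sphere_zero_iff_norm, ← sq_eq_sq₀ (norm_nonneg _) zero_le_one,
        ← real_inner_self_eq_norm_sq]
      simp only [inner_add_left, inner_add_right, real_inner_smul_left, real_inner_smul_right,
        haa, hbb, hab, hba]
      linear_combination hcs
    · rw [mem_pairsAtAngle_iff h0.le h1.le]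
      simp only [inner_add_right, real_inner_smul_right, haa, hab]
      ring
  · rintro _ ⟨⟨a, b⟩, h, rfl⟩
    rw [mem_pairsAtAngle_iff h0.le h1.le] at h
    dsimp only at h
    have ha := S2.inner_self a
    have hb := S2.inner_self b
    have h' : inner ℝ (b : E3) (a : E3) = Real.cos θ := by rw [real_inner_comm, h]
    refine ⟨ha, ?_, ?_⟩
    · simp only [pairIncl, inner_sub_left, inner_sub_right, real_inner_smul_left,
        real_inner_smul_right, ha, hb, h, h']
      field_simp
      linear_combination -hcs
    · simp only [pairIncl, inner_sub_right, real_inner_smul_right, ha, h]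
      ring
  · rintro ⟨a, b⟩ -
    simp [smul_smul, hs]
  · rintro ⟨a, b⟩ -
    simp [smul_smul, hs]

theorem smoothEquiv_sphere_diagonal :
    SmoothEquiv (Metric.sphere (0 : E3) 1) (pairIncl '' diagonal S2) := by
  refine ⟨fun a => (a, a), Prod.fst, by fun_prop, contDiff_fst, ?_, ?_, ?_, ?_⟩
  · intro a ha
    exact ⟨(⟨a, ha⟩, ⟨a, ha⟩), rfl, rfl⟩
  · rintro _ ⟨⟨a, b⟩, -, rfl⟩
    exact a.2
  · intro a _
    rfl
  · rintro _ ⟨⟨a, b⟩, h, rfl⟩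
    obtain rfl : a = b := h
    rfl

theorem SmoothEquiv.isDiffeomorphicTo {E H : Type*} [NormedAddCommGroup E] [NormedSpace ℝ E]
    [TopologicalSpace H] {I : ModelWithCorners ℝ E H} {M : Type*} [TopologicalSpace M]
    [ChartedSpace H M] {V W : Type*} [NormedAddCommGroup V] [NormedSpace ℝ V]
    [NormedAddCommGroup W] [NormedSpace ℝ W] {A : Set V} {B : Set W} (h : SmoothEquiv A B)
    (hA : IsDiffeomorphicTo I M A) : IsDiffeomorphicTo I M B := by
  obtain ⟨F, G, hF, hG, h1, h2, h3, h4⟩ := h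
  rw [← (BijOn.mk h1 h3.injOn (h4.surjOn h2)).image_eq]
  exact hA.image hF hG h3

theorem SmoothEquiv.isConnected {V W : Type*} [NormedAddCommGroup V] [NormedSpace ℝ V]
    [NormedAddCommGroup W] [NormedSpace ℝ W] {A : Set V} {B : Set W} (h : SmoothEquiv A B)
    (hA : IsConnected A) : IsConnected B := by
  obtain ⟨F, G, hF, hG, h1, h2, h3, h4⟩ := h
  rw [← (BijOn.mk h1 h3.injOn (h4.surjOn h2)).image_eq]
  exact hA.image F hF.continuous.continuousOn

theorem isDiffeomorphicToS2_sphere : IsDiffeomorphicToS2 (Metric.sphere (0 : E3) 1) := by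
  have : Fact (Module.finrank ℝ E3 = 2 + 1) := ⟨finrank_euclideanSpace_fin⟩
  exact ⟨Subtype.val, contMDiff_coe_sphere, injective_mvfderiv_subtypeVal_sphere,
    IsEmbedding.subtypeVal, Subtype.range_coe⟩

theorem isConnected_sphere_E3 : IsConnected (Metric.sphere (0 : E3) 1) := by
  refine isConnected_sphere ?_ 0 zero_le_one
  rw [← Module.finrank_eq_rank, finrank_euclideanSpace_fin]
  norm_num

theorem isDiffeomorphicToS2_diagonal : IsDiffeomorphicToS2 (pairIncl '' diagonal S2) :=
  smoothEquiv_sphere_diagonal.isDiffeomorphicTo isDiffeomorphicToS2_sphere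

theorem isDiffeomorphicToRP3_pairsAtAngle {θ : ℝ} (h0 : 0 < θ) (h1 : θ < Real.pi) :
    IsDiffeomorphicToRP3 (pairIncl '' pairsAtAngle θ) :=
  (smoothEquiv_orthonormalPairs_pairsAtAngle h0 h1).isDiffeomorphicTo
    isDiffeomorphicToRP3_orthonormalPairs

theorem isConnected_diagonal_S2 : IsConnected (diagonal S2) := by
  have h := smoothEquiv_sphere_diagonal.isConnected isConnected_sphere_E3
  exact ⟨h.nonempty.of_image, isEmbedding_pairIncl.isInducing.isPreconnected_image.mp h.2⟩

theorem isConnected_pairsAtAngle {θ : ℝ} (h0 : 0 < θ) (h1 : θ < Real.pi) :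
    IsConnected (pairsAtAngle θ) := by
  have h := (smoothEquiv_orthonormalPairs_pairsAtAngle h0 h1).isConnected
    isConnected_orthonormalPairs
  exact ⟨h.nonempty.of_image, isEmbedding_pairIncl.isInducing.isPreconnected_image.mp h.2⟩

theorem disjoint_pairsAtAngle {θ θ' : ℝ} (h : θ ≠ θ') :
    Disjoint (pairsAtAngle θ) (pairsAtAngle θ') :=
  disjoint_left.mpr fun _ hp hp' => h (Eq.trans (Eq.symm hp) hp')

theorem disjoint_diagonal_pairsAtAngle {θ : ℝ} (h : θ ≠ 0) :
    Disjoint (diagonal S2) (pairsAtAngle θ) := by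
  refine disjoint_left.mpr ?_
  rintro ⟨a, b⟩ hab hp
  obtain rfl : a = b := hab
  refine h (Eq.trans (Eq.symm hp) ?_)
  exact InnerProductGeometry.angle_self (ne_zero_of_mem_unit_sphere a)

theorem two_pi_div_five_mem : 0 < 2 * Real.pi / 5 ∧ 2 * Real.pi / 5 < Real.pi := by
  constructor <;> linarith [Real.pi_pos]

theorem four_pi_div_five_mem : 0 < 4 * Real.pi / 5 ∧ 4 * Real.pi / 5 < Real.pi := by
  constructor <;> linarith [Real.pi_pos]

theorem two_pi_div_five_ne : 2 * Real.pi / 5 ≠ 4 * Real.pi / 5 := by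
  intro h
  linarith [Real.pi_pos]

theorem componentsOf_pentagonPairs : componentsOf pentagonPairs =
    {diagonal S2, pairsAtAngle (2 * Real.pi / 5), pairsAtAngle (4 * Real.pi / 5)} :=
  componentsOf_union_three isClosed_diagonal
    (isClosed_pairsAtAngle two_pi_div_five_mem.1.le two_pi_div_five_mem.2.le)
    (isClosed_pairsAtAngle four_pi_div_five_mem.1.le four_pi_div_five_mem.2.le)
    (disjoint_diagonal_pairsAtAngle two_pi_div_five_mem.1.ne')
    (disjoint_diagonal_pairsAtAngle four_pi_div_five_mem.1.ne')
    (disjoint_pairsAtAngle two_pi_div_five_ne) isConnected_diagonal_S2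
    (isConnected_pairsAtAngle two_pi_div_five_mem.1 two_pi_div_five_mem.2)
    (isConnected_pairsAtAngle four_pi_div_five_mem.1 four_pi_div_five_mem.2)

theorem diagonal_ne_pairsAtAngle {θ : ℝ} (h : θ ≠ 0) : diagonal S2 ≠ pairsAtAngle θ :=
  (disjoint_diagonal_pairsAtAngle h).ne isConnected_diagonal_S2.nonempty.ne_empty

theorem pairsAtAngle_ne_pairsAtAngle :
    pairsAtAngle (2 * Real.pi / 5) ≠ pairsAtAngle (4 * Real.pi / 5) :=
  (disjoint_pairsAtAngle two_pi_div_five_ne).ne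
    (isConnected_pairsAtAngle two_pi_div_five_mem.1 two_pi_div_five_mem.2).nonempty.ne_empty

theorem hasSphereAndTwoProjectiveComponents_pentagonPairs :
    HasSphereAndTwoProjectiveComponents (pairIncl '' pentagonPairs) := by
  have hne : ∀ {S T : Set (S2 × S2)}, S ≠ T → pairIncl '' S ≠ pairIncl '' T :=
    fun h h' => h (isEmbedding_pairIncl.injective.image_injective h')
  refine ⟨_, _, _, ?_, hne (diagonal_ne_pairsAtAngle two_pi_div_five_mem.1.ne'),
    hne (diagonal_ne_pairsAtAngle four_pi_div_five_mem.1.ne'), hne pairsAtAngle_ne_pairsAtAngle,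
    isDiffeomorphicToS2_diagonal,
    isDiffeomorphicToRP3_pairsAtAngle two_pi_div_five_mem.1 two_pi_div_five_mem.2,
    isDiffeomorphicToRP3_pairsAtAngle four_pi_div_five_mem.1 four_pi_div_five_mem.2⟩
  rw [isEmbedding_pairIncl.componentsOf_image, componentsOf_pentagonPairs]
  simp [image_insert_eq]

/-! ### Invariance under Markov moves -/

theorem braidAct_σ (Q : Type*) [Quandle Q] {m : ℕ} (i : Fin m) :
    (braidAct Q m (BraidGroup.σ i)).unop = elementaryAct Q i := by
  unfold braidAct BraidGroup.σ
  rw [PresentedGroup.toGroup.of]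
  rfl

theorem elementaryAct_symm_apply (Q : Type*) [Quandle Q] {m : ℕ} (i : Fin m) (y : Fin (m + 1) → Q)
    (j : Fin (m + 1)) :
    (elementaryAct Q i)⁻¹ y j = if j = i.castSucc then y i.castSucc ◃⁻¹ y i.succ
      else if j = i.succ then y i.castSucc else y j := rfl

theorem braidAct_mul_apply (Q : Type*) [Quandle Q] {m : ℕ} (β γ : BraidGroup m)
    (x : Fin (m + 1) → Q) : (braidAct Q m (β * γ)).unop x =
      (braidAct Q m γ).unop ((braidAct Q m β).unop x) := by
  rw [map_mul]; rfl

theorem braidAct_inv (Q : Type*) [Quandle Q] {m : ℕ} (β : BraidGroup m) :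
    (braidAct Q m β⁻¹).unop = (braidAct Q m β).unop⁻¹ := by
  rw [map_inv]; rfl

theorem BraidGroup.induction {m : ℕ} {P : BraidGroup m → Prop} (one : P 1)
    (gen : ∀ i, P (BraidGroup.σ i)) (inv : ∀ i, P (BraidGroup.σ i)⁻¹)
    (mul : ∀ β γ, P β → P γ → P (β * γ)) (β : BraidGroup m) : P β := by
  induction β using PresentedGroup.induction_on with
  | _ w =>
    induction w using FreeGroup.induction_on with
    | C1 => exact one
    | of i => exact gen i
    | inv_of i _ => exact inv i
    | mul v w hv hw => exact mul _ _ hv hw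

theorem contDiff_ambient_sym {ι : Type*} [Fintype ι] (k l : ι) : ContDiff ℝ ∞ fun x : ι → E3 =>
    (2 * inner ℝ (x l) (x k)) • x k - x l := by
  have h : ∀ k, ContDiff ℝ ∞ fun x : ι → E3 => x k := fun k => contDiff_apply ℝ E3 k
  exact ((contDiff_const.mul ((h l).inner ℝ (h k))).smul (h k)).sub (h l)

/-- Braids act on powers of the two-sphere by restrictions of smooth maps. -/
theorem exists_contDiff_braidAct {m : ℕ} (β : BraidGroup m) :
    ∃ F : (Fin (m + 1) → E3) → (Fin (m + 1) → E3), ContDiff ℝ ∞ F ∧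
      ∀ x, F (powerIncl x) = powerIncl ((braidAct S2 m β).unop x) := by
  induction β using BraidGroup.induction with
  | one => exact ⟨id, contDiff_id, fun x => by simp⟩
  | gen i =>
    refine ⟨fun x j => if j = i.castSucc then x i.succ
      else if j = i.succ then (2 * inner ℝ (x i.castSucc) (x i.succ)) • x i.succ - x i.castSucc
      else x j, ?_, fun x => ?_⟩
    · refine contDiff_pi.mpr fun j => ?_
      split_ifs
      · exact contDiff_apply ℝ E3 _
      · exact contDiff_ambient_sym _ _
      · exact contDiff_apply ℝ E3 _
    · funext j
      simp only [powerIncl, braidAct_σ, elementaryAct_apply]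
      split_ifs <;> rfl
  | inv i =>
    refine ⟨fun x j => if j = i.castSucc then
        (2 * inner ℝ (x i.succ) (x i.castSucc)) • x i.castSucc - x i.succ
      else if j = i.succ then x i.castSucc else x j, ?_, fun x => ?_⟩
    · refine contDiff_pi.mpr fun j => ?_
      split_ifs
      · exact contDiff_ambient_sym _ _
      · exact contDiff_apply ℝ E3 _
      · exact contDiff_apply ℝ E3 _
    · funext j
      simp only [powerIncl, braidAct_inv, braidAct_σ, elementaryAct_symm_apply]
      split_ifs <;> rfl
  | mul β γ hβ hγ =>
    obtain ⟨F, hF, hF'⟩ := hβ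
    obtain ⟨G, hG, hG'⟩ := hγ
    exact ⟨G ∘ F, hG.comp hF, fun x => by
      rw [Function.comp_apply, hF', hG', braidAct_mul_apply]⟩

/-- For a right action, `γ⁻¹` carries the fixed points of `β` to those of `γ * β * γ⁻¹`, and `γ`
carries them back. -/
theorem smoothEquiv_invariantSpace_conj {m : ℕ} (β γ : BraidGroup m) :
    SmoothEquiv (powerIncl '' invariantSpace S2 β)
      (powerIncl '' invariantSpace S2 (γ * β * γ⁻¹)) := by
  obtain ⟨F, hF, hF'⟩ := exists_contDiff_braidAct γ⁻¹
  obtain ⟨G, hG, hG'⟩ := exists_contDiff_braidAct γ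
  have hγ : ∀ x, (braidAct S2 m γ).unop ((braidAct S2 m γ⁻¹).unop x) = x := fun x => by
    rw [braidAct_inv]
    exact Equiv.apply_symm_apply _ x
  have hγ' : ∀ x, (braidAct S2 m γ⁻¹).unop ((braidAct S2 m γ).unop x) = x := fun x => by
    rw [braidAct_inv]
    exact Equiv.symm_apply_apply _ x
  refine ⟨F, G, hF, hG, ?_, ?_, ?_, ?_⟩
  · rintro _ ⟨x, hx, rfl⟩
    refine ⟨_, ?_, (hF' x).symm⟩
    have hx' : (braidAct S2 m β).unop x = x := hx
    change (braidAct S2 m (γ * β * γ⁻¹)).unop _ = _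
    rw [braidAct_mul_apply, braidAct_mul_apply, hγ, hx']
  · rintro _ ⟨x, hx, rfl⟩
    refine ⟨_, ?_, (hG' x).symm⟩
    have hx' : (braidAct S2 m (γ * β * γ⁻¹)).unop x = x := hx
    rw [braidAct_mul_apply, braidAct_mul_apply] at hx'
    change (braidAct S2 m β).unop _ = _
    nth_rewrite 2 [← hx']
    rw [hγ]
  · rintro _ ⟨x, -, rfl⟩
    rw [hF', hG', hγ]
  · rintro _ ⟨x, -, rfl⟩
    rw [hG', hF', hγ']

/-! ### Stabilization by an extra strand -/

/-- The tuple `x` followed by `y`. -/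
def appendPoint {Q : Type*} {m : ℕ} (x : Fin m → Q) (y : Q) : Fin (m + 1) → Q :=
  Fin.snoc (α := fun _ => Q) x y

theorem appendPoint_last {Q : Type*} {m : ℕ} (x : Fin m → Q) (y : Q) :
    appendPoint x y (Fin.last m) = y :=
  Fin.snoc_last (α := fun _ => Q) y x

theorem appendPoint_castSucc {Q : Type*} {m : ℕ} (x : Fin m → Q) (y : Q) (j : Fin m) :
    appendPoint x y j.castSucc = x j :=
  Fin.snoc_castSucc (α := fun _ => Q) y x j

theorem elementaryAct_castSucc_appendPoint (Q : Type*) [Quandle Q] {m : ℕ} (i : Fin m)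
    (x : Fin (m + 1) → Q) (y : Q) :
    elementaryAct Q i.castSucc (appendPoint x y) = appendPoint (elementaryAct Q i x) y := by
  funext j
  refine Fin.lastCases ?_ (fun j => ?_) j
  · have h1 : Fin.last (m + 1) ≠ i.castSucc.castSucc := (Fin.castSucc_lt_last _).ne'
    have h2 : Fin.last (m + 1) ≠ i.succ.castSucc := (Fin.castSucc_lt_last _).ne'
    rw [elementaryAct_apply, if_neg h1, Fin.succ_castSucc, if_neg h2, appendPoint_last, appendPoint_last]
  · rw [elementaryAct_apply, Fin.succ_castSucc]
    simp only [Fin.castSucc_inj, appendPoint_castSucc, elementaryAct_apply]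

theorem elementaryAct_last_appendPoint (Q : Type*) [Quandle Q] {m : ℕ}
    (x : Fin (m + 1) → Q) (y : Q) :
    elementaryAct Q (Fin.last m) (appendPoint x y) =
      appendPoint (Function.update x (Fin.last m) y) (y ◃ x (Fin.last m)) := by
  funext j
  refine Fin.lastCases ?_ (fun j => ?_) j
  · have h1 : Fin.last (m + 1) ≠ (Fin.last m).castSucc := (Fin.castSucc_lt_last _).ne'
    rw [elementaryAct_apply, if_neg h1, Fin.succ_last, if_pos rfl, appendPoint_last, appendPoint_castSucc]
    exact (appendPoint_last _ _).symm
  · have h1 : j.castSucc ≠ Fin.last (m + 1) := (Fin.castSucc_lt_last _).ne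
    rw [elementaryAct_apply, Fin.succ_last, if_neg h1]
    simp only [Fin.castSucc_inj, appendPoint_castSucc, appendPoint_last, Function.update_apply]

theorem braidAct_incl (Q : Type*) [Quandle Q] {m : ℕ} (β : BraidGroup m) :
    ∀ (x : Fin (m + 1) → Q) (y : Q),
      (braidAct Q (m + 1) (BraidGroup.incl m β)).unop (appendPoint x y) =
        appendPoint ((braidAct Q m β).unop x) y := by
  have hσ : ∀ i : Fin m, BraidGroup.incl m (BraidGroup.σ i) = BraidGroup.σ i.castSucc := fun i =>
    PresentedGroup.toGroup.of _
  induction β using BraidGroup.induction with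
  | one => intro x y; simp
  | gen i =>
    intro x y
    rw [hσ, braidAct_σ, braidAct_σ, elementaryAct_castSucc_appendPoint]
  | inv i =>
    intro x y
    rw [map_inv, hσ, braidAct_inv, braidAct_inv, braidAct_σ, braidAct_σ, Equiv.Perm.inv_eq_iff_eq,
      elementaryAct_castSucc_appendPoint]
    exact congrArg (appendPoint · y) (Equiv.apply_symm_apply (elementaryAct Q i) x).symm
  | mul β γ hβ hγ =>
    intro x y
    rw [map_mul, braidAct_mul_apply, hβ, hγ, braidAct_mul_apply]

theorem appendPoint_inj {Q : Type*} {m : ℕ} {x x' : Fin m → Q} {y y' : Q} :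
    appendPoint x y = appendPoint x' y' ↔ x = x' ∧ y = y' :=
  Fin.snoc_inj

/-- Idempotence `y ◃ y = y` and injectivity of translation: the algebraic form of the first
Reidemeister move. -/
theorem act_eq_self_iff {Q : Type*} [Quandle Q] {x y : Q} : y ◃ x = y ↔ x = y := by
  rw [← Rack.left_cancel y (y := x) (y' := y), Quandle.fix]

theorem elementaryAct_last_eq_iff (Q : Type*) [Quandle Q] {m : ℕ} (u x : Fin (m + 1) → Q) (y : Q) :
    elementaryAct Q (Fin.last m) (appendPoint u y) = appendPoint x y ↔
      u = x ∧ y = x (Fin.last m) := by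
  rw [elementaryAct_last_appendPoint, appendPoint_inj, act_eq_self_iff]
  constructor
  · rintro ⟨rfl, h⟩
    simp [← h]
  · rintro ⟨rfl, rfl⟩
    simp

/-- Here `B` is the graph over `A` of the last coordinate: repeating that coordinate and forgetting
the copy are smooth and mutually inverse. -/
theorem smoothEquiv_append {m : ℕ} (A : Set (Fin (m + 1) → S2)) (B : Set (Fin (m + 2) → S2))
    (h : ∀ x y, appendPoint x y ∈ B ↔ x ∈ A ∧ y = x (Fin.last m)) :
    SmoothEquiv (powerIncl '' A) (powerIncl '' B) := by
  have hincl : ∀ (x : Fin (m + 1) → S2) (y : S2),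
      powerIncl (appendPoint x y) = appendPoint (powerIncl x) (y : E3) := fun x y => by
    funext j
    refine Fin.lastCases ?_ (fun j => ?_) j
    · simp only [powerIncl, appendPoint_last]
    · simp only [powerIncl, appendPoint_castSucc]
  have hB : ∀ w ∈ B, ∃ x ∈ A, w = appendPoint x (x (Fin.last m)) := fun w hw => by
    have hw' : w = appendPoint (fun j => w j.castSucc) (w (Fin.last (m + 1))) :=
      (Fin.snoc_init_self w).symm
    obtain ⟨h1, h2⟩ := (h _ _).mp (hw' ▸ hw)
    exact ⟨_, h1, h2 ▸ hw'⟩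
  refine ⟨fun x => appendPoint x (x (Fin.last m)), fun w j => w j.castSucc, ?_, ?_, ?_, ?_, ?_, ?_⟩
  · refine contDiff_pi.mpr fun j => ?_
    refine Fin.lastCases ?_ (fun j => ?_) j
    · simp only [appendPoint_last]
      exact contDiff_apply ℝ E3 _
    · simp only [appendPoint_castSucc]
      exact contDiff_apply ℝ E3 _
  · exact contDiff_pi.mpr fun j => contDiff_apply ℝ E3 _
  · rintro _ ⟨x, hx, rfl⟩
    exact ⟨_, (h x _).mpr ⟨hx, rfl⟩, hincl x _⟩
  · rintro _ ⟨w, hw, rfl⟩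
    obtain ⟨x, hx, rfl⟩ := hB w hw
    refine ⟨x, hx, ?_⟩
    funext j
    simp only [powerIncl, appendPoint_castSucc]
  · intro x _
    funext j
    simp only [appendPoint_castSucc]
  · rintro _ ⟨w, hw, rfl⟩
    obtain ⟨x, hx, rfl⟩ := hB w hw
    simp only [hincl, appendPoint_castSucc]
    rfl

theorem smoothEquiv_invariantSpace_stab {m : ℕ} (β : BraidGroup m) :
    SmoothEquiv (powerIncl '' invariantSpace S2 β)
      (powerIncl '' invariantSpace S2 (BraidGroup.incl m β * BraidGroup.σ (Fin.last m))) := by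
  refine smoothEquiv_append _ _ fun x y => ?_
  simp only [invariantSpace, mem_ofPred_eq]
  rw [braidAct_mul_apply, braidAct_incl, braidAct_σ, elementaryAct_last_eq_iff]

theorem smoothEquiv_invariantSpace_stabInv {m : ℕ} (β : BraidGroup m) :
    SmoothEquiv (powerIncl '' invariantSpace S2 β)
      (powerIncl '' invariantSpace S2 (BraidGroup.incl m β * (BraidGroup.σ (Fin.last m))⁻¹)) := by
  refine smoothEquiv_append _ _ fun x y => ?_
  simp only [invariantSpace, mem_ofPred_eq]
  -- Moving the inverse generator across turns negative stabilization into the positive equation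
  -- with its sides exchanged.
  rw [braidAct_mul_apply, braidAct_incl, braidAct_inv, braidAct_σ, Equiv.Perm.inv_eq_iff_eq,
    eq_comm, elementaryAct_last_eq_iff]
  constructor
  · rintro ⟨h1, h2⟩
    exact ⟨h1.symm, h1 ▸ h2⟩
  · rintro ⟨h1, h2⟩
    exact ⟨h1.symm, h1.symm ▸ h2⟩

theorem MarkovEquivalent.smoothEquiv {a b : Σ m : ℕ, BraidGroup m} (h : MarkovEquivalent a b) :
    SmoothEquiv (powerIncl '' invariantSpace S2 a.2) (powerIncl '' invariantSpace S2 b.2) := by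
  induction h with
  | rel a b h =>
    cases h with
    | conj m β γ => exact smoothEquiv_invariantSpace_conj β γ
    | stab m β => exact smoothEquiv_invariantSpace_stab β
    | stabInv m β => exact smoothEquiv_invariantSpace_stabInv β
  | refl a => exact SmoothEquiv.refl _
  | symm a b _ ih => exact ih.symm
  | trans a b c _ _ ih ih' => exact ih.trans ih'

/-! ### The invariant space of the three-strand braid -/

theorem mem_invariantSpace_figureEightBraid (x : Fin 3 → S2) :
    x ∈ invariantSpace S2 figureEightBraid ↔
      (x 0, x 1) ∈ pentagonPairs ∧ x 2 = S2.sym (x 0) (x 1) := by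
  -- Being fixed by `σ₁σ₂⁻¹σ₁σ₂⁻¹` means that `σ₁σ₂⁻¹` and `σ₂σ₁⁻¹` agree on `x`. Splitting the word
  -- evenly keeps the coordinate equations short.
  have h : x ∈ invariantSpace S2 figureEightBraid ↔
      (elementaryAct S2 (1 : Fin 2))⁻¹ (elementaryAct S2 0 x) =
        (elementaryAct S2 (0 : Fin 2))⁻¹ (elementaryAct S2 1 x) := by
    simp only [invariantSpace, mem_ofPred_eq, figureEightBraid, pow_two]
    rw [braidAct_mul_apply, braidAct_mul_apply, braidAct_mul_apply, braidAct_inv, braidAct_σ,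
      braidAct_σ, Equiv.Perm.inv_eq_iff_eq, Equiv.Perm.eq_inv_iff_eq]
  have h' : x ∈ invariantSpace S2 figureEightBraid ↔ x 1 = S2.sym (x 0) (x 2) ∧
      S2.sym (S2.sym (x 1) (x 0)) (x 2) = x 0 ∧ S2.sym (x 1) (x 0) = S2.sym (x 2) (x 1) := by
    rw [h, funext_iff, Fin.forall_fin_succ, Fin.forall_fin_two]
    simp [elementaryAct_symm_apply, elementaryAct_apply, S2.act_def, S2.invAct_def, Fin.ext_iff]
  rw [h']
  constructor
  -- The first equation determines `x 2`, the third is the pentagon relation for `(x 1, x 0)`, and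
  -- the middle one is redundant.
  · rintro ⟨h1, -, h3⟩
    have h2 : x 2 = S2.sym (x 0) (x 1) := by rw [h1, S2.sym_sym]
    refine ⟨swap_mem_pentagonPairs ?_, h2⟩
    rw [mem_pentagonPairs_iff, h3, h2, S2.sym_sym_apply]
  · rintro ⟨h1, h2⟩
    have h3 := swap_mem_pentagonPairs h1
    rw [mem_pentagonPairs_iff] at h3
    refine ⟨by rw [h2, S2.sym_sym], ?_, ?_⟩
    · rw [h2, S2.sym_sym_apply, h3, S2.sym_sym]
    · rw [h2, S2.sym_sym_apply, h3]

theorem smoothEquiv_pentagonPairs_invariantSpace :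
    SmoothEquiv (pairIncl '' pentagonPairs) (powerIncl '' invariantSpace S2 figureEightBraid) := by
  refine ⟨fun p => ![p.1, p.2, (2 * inner ℝ p.2 p.1) • p.1 - p.2], fun x => (x 0, x 1),
    ?_, ?_, ?_, ?_, ?_, ?_⟩
  · refine contDiff_pi.mpr fun j => ?_
    fin_cases j
    · exact contDiff_fst
    · exact contDiff_snd
    · exact ((contDiff_const.mul (contDiff_snd.inner ℝ contDiff_fst)).smul contDiff_fst).sub
        contDiff_snd
  · exact (contDiff_apply ℝ E3 0).prodMk (contDiff_apply ℝ E3 1)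
  · rintro _ ⟨⟨a, b⟩, h, rfl⟩
    refine ⟨![a, b, S2.sym a b], (mem_invariantSpace_figureEightBraid _).mpr ⟨h, rfl⟩, ?_⟩
    funext j
    fin_cases j <;> rfl
  · rintro _ ⟨x, hx, rfl⟩
    exact ⟨_, ((mem_invariantSpace_figureEightBraid x).mp hx).1, rfl⟩
  · intro p _
    rfl
  · rintro _ ⟨x, hx, rfl⟩
    have h2 := ((mem_invariantSpace_figureEightBraid x).mp hx).2
    funext j
    fin_cases j
    · rfl
    · rfl
    · exact (congrArg Subtype.val h2).symm

theorem HasSphereAndTwoProjectiveComponents.of_image_powerIncl {ι : Type*} [Fintype ι]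
    {S : Set (ι → S2)} (h : HasSphereAndTwoProjectiveComponents (powerIncl '' S)) :
    ∃ C₀ C₁ C₂ : Set (ι → S2), componentsOf S = {C₀, C₁, C₂} ∧ C₀ ≠ C₁ ∧ C₀ ≠ C₂ ∧ C₁ ≠ C₂ ∧
      IsDiffeomorphicToS2 (powerIncl '' C₀) ∧ IsDiffeomorphicToRP3 (powerIncl '' C₁) ∧
      IsDiffeomorphicToRP3 (powerIncl '' C₂) := by
  obtain ⟨C₀, C₁, C₂, hC, n1, n2, n3, d0, d1, d2⟩ := h
  rw [(isEmbedding_powerIncl ι).componentsOf_image] at hC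
  have hmem : ∀ C ∈ ({C₀, C₁, C₂} : Set (Set (ι → E3))), ∃ D, powerIncl '' D = C := by
    rw [← hC]
    rintro _ ⟨D, -, rfl⟩
    exact ⟨D, rfl⟩
  obtain ⟨D₀, rfl⟩ := hmem C₀ (by simp)
  obtain ⟨D₁, rfl⟩ := hmem C₁ (by simp)
  obtain ⟨D₂, rfl⟩ := hmem C₂ (by simp)
  refine ⟨D₀, D₁, D₂, ?_, ne_of_apply_ne _ n1, ne_of_apply_ne _ n2, ne_of_apply_ne _ n3,
    d0, d1, d2⟩
  -- Components are sets of sets, so injectivity is lifted through images twice.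
  apply (isEmbedding_powerIncl ι).injective.image_injective.image_injective
  rw [hC]
  simp [image_insert_eq]

theorem mainTheorem8 :
    -- the invariant space, computed from any braid whose closure is the figure-eight knot
    (∀ (m : ℕ) (β : BraidGroup m), MarkovEquivalent ⟨m, β⟩ ⟨2, figureEightBraid⟩ →
      ∃ C₀ C₁ C₂ : Set (Fin (m + 1) → S2),
        componentsOf (invariantSpace S2 β) = {C₀, C₁, C₂} ∧
        C₀ ≠ C₁ ∧ C₀ ≠ C₂ ∧ C₁ ≠ C₂ ∧
        IsDiffeomorphicToS2 (powerIncl '' C₀) ∧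
        IsDiffeomorphicToRP3 (powerIncl '' C₁) ∧
        IsDiffeomorphicToRP3 (powerIncl '' C₂)) ∧
    -- the space of colourings of the standard diagram, embedded in `S² × S²` by `(a, b)`,
    -- and its three components
    IsEmbedding figureEightPair ∧
    range figureEightPair =
      diagonal S2 ∪ pairsAtAngle (2 * Real.pi / 5) ∪ pairsAtAngle (4 * Real.pi / 5) ∧
    componentsOf (range figureEightPair) =
      {diagonal S2, pairsAtAngle (2 * Real.pi / 5), pairsAtAngle (4 * Real.pi / 5)} ∧
    diagonal S2 ≠ pairsAtAngle (2 * Real.pi / 5) ∧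
    diagonal S2 ≠ pairsAtAngle (4 * Real.pi / 5) ∧
    pairsAtAngle (2 * Real.pi / 5) ≠ pairsAtAngle (4 * Real.pi / 5) ∧
    IsDiffeomorphicToS2 (pairIncl '' diagonal S2) ∧
    IsDiffeomorphicToRP3 (pairIncl '' pairsAtAngle (2 * Real.pi / 5)) ∧
    IsDiffeomorphicToRP3 (pairIncl '' pairsAtAngle (4 * Real.pi / 5)) := by
  refine ⟨fun m β h => ?_, isEmbedding_figureEightPair, range_figureEightPair, ?_,
    diagonal_ne_pairsAtAngle two_pi_div_five_mem.1.ne',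
    diagonal_ne_pairsAtAngle four_pi_div_five_mem.1.ne', pairsAtAngle_ne_pairsAtAngle,
    isDiffeomorphicToS2_diagonal,
    isDiffeomorphicToRP3_pairsAtAngle two_pi_div_five_mem.1 two_pi_div_five_mem.2,
    isDiffeomorphicToRP3_pairsAtAngle four_pi_div_five_mem.1 four_pi_div_five_mem.2⟩
  · exact (hasSphereAndTwoProjectiveComponents_pentagonPairs.of_smoothEquiv
      (smoothEquiv_pentagonPairs_invariantSpace.trans h.smoothEquiv.symm)).of_image_powerIncl
  · rw [range_figureEightPair]
    exact componentsOf_pentagonPairs
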